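/- **Notation.** For $g:\mathbb R^d\to(-\infty,\infty]$, put $\operatorname{dom} g=\{x: g(x)<\infty\}$ and let $\partial g(x)$, $x\in\operatorname{dom} g$, be the limiting (Mordukhovich) subdifferential, i.e. the set of $v$ such that $(v,-1)$ is a limiting normal to the epigraph of $g$ at $(x,g(x))$. The subderivative, the second subderivative and the critical cone of $g$ are $$\mathrm dg(x)(w)=\liminf_{t\downarrow0,\,u\to w}\frac{g(x+tu)-g(x)}{t},\qquad \mathrm d^2g(x,v)(w)=\liminf_{t\downarrow0,\,u\to w}\frac{g(x+tu)-g(x)-t\langle v,u\rangle}{\frac12t^2},$$ $$K_g(x,v)=\{w:\ \mathrm dg(x)(w)=\langle v,w\rangle\}.$$ The function $g$ is *piecewise linear-quadratic* if $\operatorname{dom} g$ is a union of finitely many polyhedral convex sets $\Omega_i$ and $g(x)=\frac12\langle A_ix,x\rangle+\langle a_i,x\rangle+\alpha_i$ on $\Omega_i$, with $A_i$ symmetric, $a_i\in\mathbb R^d$ and $\alpha_i\in\mathbb R$. A mapping is *twice differentiable* at a point if it is differentiable near the point and its derivative is differentiable at the point. **Theorem.** Let $\varphi_0:\mathbb R^n\to\mathbb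 R$ and $f:\mathbb R^n\to\mathbb R^m$ be twice differentiable at $\bar x$, let $\vartheta:\mathbb R^m\to(-\infty,\infty]$ be convex and piecewise linear-quadratic with $f(\bar x)\in\operatorname{dom}\vartheta$, and put $\varphi=\vartheta\circ f$ and $\psi=\varphi_0+\vartheta\circ f$. Assume the metric subregularity qualification condition at $\bar x$: there are $\kappa\ge0$ and a neighbourhood $U$ of $\bar x$ such that $$\operatorname{dist}\big(x;\{z: f(z)\in\operatorname{dom}\vartheta\}\big)\le\kappa\,\operatorname{dist}\big(f(x);\operatorname{dom}\vartheta\big)\quad\text{for all }x\in U.$$ Assume also that $\bar x$ is stationary: $0\in\nabla\varphi_0(\bar x)+\partial\varphi(\bar x)$. Let $\bar v=-\nabla\varphi_0(\bar x)$, $K=K_\varphi(\bar x,\bar v)$, $$\Lambda=\{\lambda\in\mathbb R^m:\ \nabla f(\bar x)^*\lambda=\bar v,\ \lambda\in\partial\vartheta(f(\bar x))\},\qquad L(x,\lambda)=\varphi_0(x)+\langle\lambda,f(x)\rangle-\vartheta^*(\lambda),$$ where $\vartheta^*$ is the Fenchel conjugate. Then $\Lambda\neq\emptyset$, for every $w\in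 K$ the maximum of $\langle\nabla^2_{xx}L(\bar x,\lambda)w,w\rangle$ over $\lambda\in\Lambda$ is attained, and the following hold. (i) If $\bar x$ is a local minimizer of $\psi$, then for every $\bar\lambda\in\Lambda$ $$\mathrm d^2\vartheta\big(f(\bar x),\bar\lambda\big)\big(\nabla f(\bar x)w\big)+\max_{\lambda\in\Lambda}\big\langle\nabla^2_{xx}L(\bar x,\lambda)w,w\big\rangle\ge0\quad\text{for all }w\in K.$$ (ii) For every $\bar\lambda\in\Lambda$, the condition $$\mathrm d^2\vartheta\big(f(\bar x),\bar\lambda\big)\big(\nabla f(\bar x)w\big)+\max_{\lambda\in\Lambda}\big\langle\nabla^2_{xx}L(\bar x,\lambda)w,w\big\rangle>0\quad\text{for all }w\in K\setminus\{0\}$$ holds if and only if there are $\ell>0$ and $\varepsilon>0$ such that $\psi(x)\ge\psi(\bar x)+\ell\|x-\bar x\|^2$ whenever $\|x-\bar x\|\le\varepsilon$. In particular, this condition is sufficient for $\bar x$ to be a local minimizer of $\psi$. -/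

import Mathlib

open Filter Topology
open scoped RealInnerProductSpace

noncomputable section

namespace CompositeOpt

variable {E F : Type*} [NormedAddCommGroup E] [InnerProductSpace ℝ E]
  [NormedAddCommGroup F] [InnerProductSpace ℝ F]

/-- The effective domain of an extended-real-valued function. -/
def dom (φ : E → EReal) : Set E := {x | φ x < ⊤}

/-- The epigraph of `φ`, as a subset of the Euclidean product `E × ℝ`. -/
def epi (φ : E → EReal) : Set (WithLp 2 (E × ℝ)) := {z | φ z.fst ≤ (z.snd : EReal)}

/-- The Fréchet regular normal cone: `limsup ⟪v, x - x₀⟫ / ‖x - x₀‖ ≤ 0` as `x → x₀` in `Ω`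
(meant for `x₀ ∈ Ω`). -/
def regularNormalCone (Ω : Set E) (x₀ : E) : Set E :=
  {v | ∀ ε > 0, ∀ᶠ x in 𝓝[Ω] x₀, ⟪v, x - x₀⟫ ≤ ε * ‖x - x₀‖}

/-- The limiting (Mordukhovich) normal cone (meant for `x₀ ∈ Ω`). -/
def limitingNormalCone (Ω : Set E) (x₀ : E) : Set E :=
  {v | ∃ (x : ℕ → E) (u : ℕ → E), (∀ k, x k ∈ Ω) ∧ Tendsto x atTop (𝓝 x₀) ∧
    Tendsto u atTop (𝓝 v) ∧ ∀ k, u k ∈ regularNormalCone Ω (x k)}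

/-- The limiting subdifferential, through limiting normals to the epigraph;
empty off the domain. -/
def limitingSubdiff (φ : E → EReal) (x₀ : E) : Set E :=
  {v | x₀ ∈ dom φ ∧
    WithLp.toLp 2 (v, (-1 : ℝ)) ∈
      limitingNormalCone (epi φ) (WithLp.toLp 2 (x₀, (φ x₀).toReal))}

/-- The subderivative: `liminf (φ (x₀ + t w') - φ x₀) / t` as `t ↓ 0`, `w' → w`. -/
def subderiv (φ : E → EReal) (x₀ w : E) : EReal :=
  liminf (fun p : ℝ × E => (φ (x₀ + p.1 • p.2) - φ x₀) / (p.1 : EReal))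
    (𝓝[>] (0 : ℝ) ×ˢ 𝓝 w)

/-- The second subderivative of `φ` at `x₀` for `v`:
`liminf (φ (x₀ + t u) - φ x₀ - t ⟪v, u⟫) / (t² / 2)` as `t ↓ 0`, `u → w`. -/
def secondSubderiv (φ : E → EReal) (x₀ v w : E) : EReal :=
  liminf
    (fun p : ℝ × E =>
      (φ (x₀ + p.1 • p.2) - φ x₀ - ((p.1 * ⟪v, p.2⟫ : ℝ) : EReal)) /
        ((p.1 ^ 2 / 2 : ℝ) : EReal))
    (𝓝[>] (0 : ℝ) ×ˢ 𝓝 w)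

/-- The critical cone of `φ` at `x₀` for `v`. -/
def criticalCone (φ : E → EReal) (x₀ v : E) : Set E :=
  {w | subderiv φ x₀ w = ((⟪v, w⟫ : ℝ) : EReal)}

/-- Polyhedral convex sets: finite intersections of closed half-spaces. -/
def IsPolyhedralConvex (C : Set E) : Prop :=
  ∃ (p : ℕ) (b : Fin p → E) (c : Fin p → ℝ), C = {x | ∀ j, ⟪b j, x⟫ ≤ c j}

/-- Convexity of an extended-real-valued function. -/
def IsConvexFun (φ : E → EReal) : Prop := Convex ℝ (epi φ)

/-- Piecewise linear-quadratic functions with values in `(-∞, ∞]`. -/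
def IsPWLQ (φ : E → EReal) : Prop :=
  (∀ x, φ x ≠ ⊥) ∧
  ∃ (s : ℕ) (Ω : Fin s → Set E) (A : Fin s → E →ₗ[ℝ] E) (a : Fin s → E) (α : Fin s → ℝ),
    (∀ i, IsPolyhedralConvex (Ω i)) ∧ (∀ i, (A i).IsSymmetric) ∧
    dom φ = (⋃ i, Ω i) ∧
    ∀ i, ∀ x ∈ Ω i, φ x = ((1 / 2 * ⟪A i x, x⟫ + ⟪a i, x⟫ + α i : ℝ) : EReal)

/-- Twice differentiability at a point: differentiable nearby, with a derivative that is
differentiable at the point. -/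
def TwiceDifferentiableAt (f : E → F) (x₀ : E) : Prop :=
  (∀ᶠ x in 𝓝 x₀, DifferentiableAt ℝ f x) ∧ DifferentiableAt ℝ (fderiv ℝ f) x₀

/-- The metric subregularity qualification condition for `ϑ ∘ f` at `x₀`. -/
def MSQC (ϑ : F → EReal) (f : E → F) (x₀ : E) : Prop :=
  ∃ κ : ℝ, 0 ≤ κ ∧ ∀ᶠ x in 𝓝 x₀,
    Metric.infDist x {z | f z ∈ dom ϑ} ≤ κ * Metric.infDist (f x) (dom ϑ)

/-- The Fenchel conjugate. -/
def conjugate (ϑ : F → EReal) (lam : F) : EReal :=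
  ⨆ y, (((⟪lam, y⟫ : ℝ) : EReal) - ϑ y)

/-- The Lagrangian `φ₀ x + ⟪λ, f x⟫ - ϑ* λ`. It is only used at subgradients `λ` of `ϑ`,
where the conjugate is finite, so that `toReal` loses nothing. -/
def lagrangian (φ₀ : E → ℝ) (ϑ : F → EReal) (f : E → F) (x : E) (lam : F) : ℝ :=
  φ₀ x + ⟪lam, f x⟫ - (conjugate ϑ lam).toReal

/-- The quadratic form `⟪∇²ₓₓ L (x₀, λ) w, w⟫` of the Hessian of the Lagrangian in `x`. -/
def lagrangianHessian (φ₀ : E → ℝ) (ϑ : F → EReal) (f : E → F) (x₀ : E) (lam : F)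
    (w : E) : ℝ :=
  fderiv ℝ (fderiv ℝ (fun x => lagrangian φ₀ ϑ f x lam)) x₀ w w

/-- The multiplier set `{λ ∈ ∂ϑ (f x₀) | ∇f(x₀)* λ = v}`. -/
def multipliers [CompleteSpace E] [CompleteSpace F]
    (ϑ : F → EReal) (f : E → F) (x₀ v : E) : Set F :=
  {lam | ContinuousLinearMap.adjoint (fderiv ℝ f x₀) lam = v ∧ lam ∈ limitingSubdiff ϑ (f x₀)}

/-- The left-hand side of the second-order conditions:
`d²ϑ(f x₀, λ₀)(∇f(x₀) w) + sup {⟪∇²ₓₓ L (x₀, λ) w, w⟫ | λ ∈ Λ}`. -/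
def secondOrderExpr (φ₀ : E → ℝ) (ϑ : F → EReal) (f : E → F) (x₀ : E) (Λ : Set F)
    (lam₀ : F) (w : E) : EReal :=
  secondSubderiv ϑ (f x₀) lam₀ (fderiv ℝ f x₀ w) +
    ⨆ lam ∈ Λ, (lagrangianHessian φ₀ ϑ f x₀ lam w : EReal)

/-- Quadratic growth of `ψ` at `x₀`. -/
def QuadraticGrowth (ψ : E → EReal) (x₀ : E) : Prop :=
  ∃ ℓ : ℝ, 0 < ℓ ∧ ∃ ε : ℝ, 0 < ε ∧ ∀ x ∈ Metric.closedBall x₀ ε,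
    ψ x₀ + ((ℓ * ‖x - x₀‖ ^ 2 : ℝ) : EReal) ≤ ψ x

end CompositeOpt

end

namespace CompositeOpt

/-! Let `v` be minus the gradient of `φ₀` at the base point `x`. The proof studies, for each
direction `w`, the numbers `μ` for which `θ ∘ f - ⟪v, ·⟫` grows at least like `μ t² / 2` along `t ↓
0` and directions tending to `w` (`SecondOrderBound`). Adding `φ₀` only shifts `μ` by its Hessian.
If `w` is critical, the convex piecewise linear-quadratic `θ` is a quadratic polynomial on an
initial piece of the ray from `f x` along `∇f(x) w`. Its curvature `c` is the second subderivative
of `ϑ` for every multiplier at once, since all multipliers have the same slope `⟪v, w⟫` there. The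
theorem then follows from a chain rule: the supremum of the admissible `μ` is `c + max ⟪λ, ∇²f(x)(w,
w)⟫` over the multipliers.

The lower estimate (`secondOrderBound_of_multiplier`) combines the second-order behaviour of `θ` at
a subgradient with Taylor's formula for `f`. The upper estimate
(`exists_multiplier_of_secondOrderBound`) uses metric subregularity as an exact penalty: a nearly
feasible pair `(x + t w + t² p / 2, y_t)` with `y_t ∈ D` can be corrected to a feasible point at a
cost proportional to the residual. Testing with such curves gives an inequality with a norm penalty,
and separation (`exists_multiplier_of_penalty`) turns it into one multiplier whose norm is bounded
by the penalty constants. This bound does not depend on `μ`, so the maximum is attained even if the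
multiplier set is unbounded. The first-order version of the argument, followed by a passage to the
limit, shows that multipliers exist.

A local minimizer makes `0` admissible for the full objective in every direction. Quadratic growth
means that some positive `μ` is admissible in every nonzero direction, by compactness of the unit
sphere. Noncritical directions impose nothing, because there a first-order gap dominates every
multiple of `t²`. -/

/-- Piecewise linear-quadratic real functions on a domain. -/
def IsPWLQOn {F : Type*} [NormedAddCommGroup F] [InnerProductSpace ℝ F]
    (D : Set F) (θ : F → ℝ) : Prop :=
  ∃ (s : ℕ) (Ω : Fin s → Set F) (A : Fin s → F →ₗ[ℝ] F) (a : Fin s → F) (α : Fin s → ℝ),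
    (∀ i, IsPolyhedralConvex (Ω i)) ∧ (∀ i, (A i).IsSymmetric) ∧ D = (⋃ i, Ω i) ∧
    ∀ i, ∀ x ∈ Ω i, θ x = 1 / 2 * ⟪A i x, x⟫ + ⟪a i, x⟫ + α i

/-- Subgradients of `θ` on `D`, in the sense of convex analysis. -/
def ConvexSubgrad {F : Type*} [NormedAddCommGroup F] [InnerProductSpace ℝ F]
    (D : Set F) (θ : F → ℝ) (z : F) : Set F :=
  {lam | ∀ y ∈ D, θ z + ⟪lam, y - z⟫ ≤ θ y}

/-! ### Polyhedral sets and elementary limits -/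

section Basic

variable {F : Type*} [NormedAddCommGroup F] [InnerProductSpace ℝ F]

theorem IsPolyhedralConvex.isClosed {C : Set F} (h : IsPolyhedralConvex C) : IsClosed C := by
  obtain ⟨p, b, c, rfl⟩ := h
  simp only [Set.ofPred_forall]
  exact isClosed_iInter fun j => isClosed_le (by fun_prop) continuous_const

theorem IsPolyhedralConvex.convex {C : Set F} (h : IsPolyhedralConvex C) : Convex ℝ C := by
  obtain ⟨p, b, c, rfl⟩ := h
  simp only [Set.ofPred_forall]
  exact convex_iInter fun j => convex_halfSpace_le (innerSL ℝ (b j)).toLinearMap.isLinear (c j)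

theorem tendsto_add_smul_nhds (z u : F) :
    Tendsto (fun p : ℝ × F => z + p.1 • p.2) (𝓝[>] (0 : ℝ) ×ˢ 𝓝 u) (𝓝 z) := by
  have h : Tendsto (fun p : ℝ × F => z + p.1 • p.2) (𝓝 (0 : ℝ) ×ˢ 𝓝 u) (𝓝 (z + (0 : ℝ) • u)) := by
    rw [← nhds_prod_eq]
    exact Continuous.tendsto (f := fun p : ℝ × F => z + p.1 • p.2) (by fun_prop) (0, u)
  rw [zero_smul, add_zero] at h
  exact h.mono_left (prod_mono nhdsWithin_le_nhds le_rfl)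

/-- Tangent directions to a polyhedral set are feasible directions. -/
theorem IsPolyhedralConvex.ray_mem {C : Set F} (h : IsPolyhedralConvex C) {z u : F}
    (hf : ∃ᶠ p in 𝓝[>] (0 : ℝ) ×ˢ 𝓝 u, z + p.1 • p.2 ∈ C) :
    z ∈ C ∧ ∀ᶠ t in 𝓝[>] (0 : ℝ), z + t • u ∈ C := by
  have hz : z ∈ C := h.isClosed.mem_of_frequently_of_tendsto hf (tendsto_add_smul_nhds z u)
  refine ⟨hz, ?_⟩
  obtain ⟨p, b, c, rfl⟩ := h
  simp only [Set.mem_ofPred_eq] at hz hf ⊢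
  rw [eventually_all]
  intro j
  -- An inactive constraint persists by continuity. An active one forces `⟪b j, ·⟫ ≤ 0` on the
  -- nearby feasible directions, hence on their limit `u`.
  rcases (hz j).lt_or_eq with hlt | heq
  · have h1 : Tendsto (fun t : ℝ => ⟪b j, z + t • u⟫) (𝓝[>] 0) (𝓝 ⟪b j, z + (0 : ℝ) • u⟫) :=
      (Continuous.tendsto (f := fun t : ℝ => ⟪b j, z + t • u⟫) (by fun_prop) 0).mono_left
        nhdsWithin_le_nhds
    rw [zero_smul, add_zero] at h1
    filter_upwards [h1.eventually (gt_mem_nhds hlt)] with t ht using le_of_lt ht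
  · have hu : ⟪b j, u⟫ ≤ 0 := by
      have hcl : IsClosed {u : F | ⟪b j, u⟫ ≤ 0} := isClosed_le (by fun_prop) continuous_const
      refine hcl.mem_of_frequently_of_tendsto ?_
        (tendsto_snd : Tendsto (fun p : ℝ × F => p.2) (𝓝[>] (0 : ℝ) ×ˢ 𝓝 u) (𝓝 u))
      have hpos : ∀ᶠ p in 𝓝[>] (0 : ℝ) ×ˢ 𝓝 u, 0 < p.1 :=
        tendsto_fst.eventually self_mem_nhdsWithin
      refine (hf.and_eventually hpos).mono fun q hq => ?_
      have := hq.1 j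
      rw [inner_add_right, inner_smul_right, heq] at this
      have h0 := hq.2
      change ⟪b j, q.2⟫ ≤ 0
      by_contra hc
      push Not at hc
      nlinarith [mul_pos h0 hc]
    filter_upwards [self_mem_nhdsWithin] with t ht
    rw [inner_add_right, inner_smul_right, heq]
    have : (0 : ℝ) < t := ht
    nlinarith

theorem quadratic_expand {A : F →ₗ[ℝ] F} (hA : A.IsSymmetric) (a : F) (α : ℝ) (z u : F) (t : ℝ) :
    1 / 2 * ⟪A (z + t • u), z + t • u⟫ + ⟪a, z + t • u⟫ + α
      = (1 / 2 * ⟪A z, z⟫ + ⟪a, z⟫ + α) + t * ⟪A z + a, u⟫ + t ^ 2 / 2 * ⟪A u, u⟫ := by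
  have h1 : ⟪A u, z⟫ = ⟪A z, u⟫ := by rw [hA u z, real_inner_comm]
  simp only [map_add, map_smul, inner_add_left, inner_add_right, inner_smul_left,
    inner_smul_right, h1]
  simp
  ring

theorem nonneg_of_forall_pos_le_mul {a b : ℝ} (h : ∀ s : ℝ, 0 < s → b ≤ s * a) : 0 ≤ a := by
  by_contra hc
  push Not at hc
  have h1 := h ((|b| + 1) / (-a)) (div_pos (by positivity) (by linarith))
  have h2 : (|b| + 1) / (-a) * a = -(|b| + 1) := by
    field_simp [hc.ne]
  rw [h2] at h1
  have := neg_abs_le b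
  linarith

/-- Coefficients of a quadratic polynomial are determined by its values near `0`. -/
theorem coeffs_eq_of_eventually_eq {a b a' b' : ℝ}
    (h : ∀ᶠ t in 𝓝[>] (0 : ℝ), t * a + t ^ 2 / 2 * b = t * a' + t ^ 2 / 2 * b') :
    a = a' ∧ b = b' := by
  have key : ∀ᶠ t in 𝓝[>] (0 : ℝ), a - a' = t * ((b' - b) / 2) := by
    filter_upwards [h, self_mem_nhdsWithin] with t ht h0
    have h0 : (0 : ℝ) < t := h0
    apply mul_left_cancel₀ h0.ne'
    linarith
  have lim : Tendsto (fun t : ℝ => t * ((b' - b) / 2)) (𝓝[>] 0) (𝓝 (0 * ((b' - b) / 2))) :=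
    (Continuous.tendsto (f := fun t : ℝ => t * ((b' - b) / 2)) (by fun_prop) 0).mono_left
      nhdsWithin_le_nhds
  have ha : a - a' = 0 := by
    have := tendsto_nhds_unique (tendsto_const_nhds.congr' key) lim
    simpa using this
  refine ⟨by linarith, ?_⟩
  obtain ⟨t, ht, h0⟩ := (key.and self_mem_nhdsWithin).exists
  have h0 : (0 : ℝ) < t := h0
  rw [ha] at ht
  have := (mul_eq_zero.mp ht.symm).resolve_left h0.ne'
  linarith

end Basic

/-! ### Convex piecewise linear-quadratic functions -/

section PWLQ

variable {F : Type*} [NormedAddCommGroup F] [InnerProductSpace ℝ F]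
  {D : Set F} {θ : F → ℝ}

/-- A convex piecewise linear-quadratic function is Lipschitz on bounded parts of its domain. -/
theorem IsPWLQOn.lipschitz [FiniteDimensional ℝ F] (h : IsPWLQOn D θ) (hc : ConvexOn ℝ D θ)
    (R : ℝ) (hR : 0 ≤ R) :
    ∃ ℓ : ℝ, 0 ≤ ℓ ∧ ∀ y ∈ D, ∀ y' ∈ D, ‖y‖ ≤ R → ‖y'‖ ≤ R → θ y' - θ y ≤ ℓ * ‖y' - y‖ := by
  obtain ⟨s, Ω, A, a, α, hΩ, hA, rfl, hq⟩ := h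
  -- `B i` bounds the gradient of the `i`-th quadratic on the ball of radius `R`. There is no need
  -- to cross all pieces between `y` and `y'`: some piece contains `y'` and an earlier point `x` of
  -- the segment, and by convexity the mean slope from `y` to `y'` is at most that from `x` to `y'`.
  set B : Fin s → ℝ := fun i => ‖LinearMap.toContinuousLinearMap (A i)‖ * R + ‖a i‖
  have hB : ∀ i, 0 ≤ B i := fun i => by positivity
  refine ⟨∑ i, B i, Finset.sum_nonneg fun i _ => hB i, ?_⟩
  intro y hy y' hy' hyR hyR'
  have hseg : ∀ r : ℝ, 0 ≤ r → r ≤ 1 → y + r • (y' - y) ∈ ⋃ i, Ω i := fun r h0 h1 => by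
    have := hc.1 hy hy' (sub_nonneg.2 h1) h0 (by ring)
    convert this using 1
    module
  have hfreq : ∃ᶠ r in 𝓝[<] (1 : ℝ), ∃ i, y + r • (y' - y) ∈ Ω i := by
    apply Eventually.frequently
    have : Set.Ioo (0 : ℝ) 1 ∈ 𝓝[<] (1 : ℝ) := Ioo_mem_nhdsLT one_pos
    filter_upwards [this] with r hr
    simpa using hseg r hr.1.le hr.2.le
  obtain ⟨i, hi⟩ : ∃ i, ∃ᶠ r in 𝓝[<] (1 : ℝ), y + r • (y' - y) ∈ Ω i := by
    by_contra hcon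
    push Not at hcon
    apply hfreq
    have := eventually_all.2 hcon
    filter_upwards [this] with r hr
    push Not
    exact hr
  have hlim : Tendsto (fun r : ℝ => y + r • (y' - y)) (𝓝[<] 1) (𝓝 y') := by
    have : Tendsto (fun r : ℝ => y + r • (y' - y)) (𝓝 1) (𝓝 (y + (1 : ℝ) • (y' - y))) :=
      Continuous.tendsto (f := fun r : ℝ => y + r • (y' - y)) (by fun_prop) 1
    rw [one_smul, add_sub_cancel] at this
    exact this.mono_left nhdsWithin_le_nhds
  have hy'i : y' ∈ Ω i := (hΩ i).isClosed.mem_of_frequently_of_tendsto hi hlim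
  have hev : ∀ᶠ r in 𝓝[<] (1 : ℝ), r ∈ Set.Ioo (0 : ℝ) 1 := Ioo_mem_nhdsLT one_pos
  obtain ⟨r, hri, hr0, hr1⟩ := (hi.and_eventually hev).exists
  set x := y + r • (y' - y) with hx
  have hxR : ‖x‖ ≤ R := by
    have : x = (1 - r) • y + r • y' := by rw [hx]; module
    rw [this]
    calc _ ≤ ‖(1 - r) • y‖ + ‖r • y'‖ := norm_add_le _ _
      _ = (1 - r) * ‖y‖ + r * ‖y'‖ := by
        rw [norm_smul, norm_smul, Real.norm_of_nonneg (by linarith), Real.norm_of_nonneg hr0.le]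
      _ ≤ (1 - r) * R + r * R := by gcongr
      _ = R := by ring
  have hconv : θ x ≤ (1 - r) * θ y + r * θ y' := by
    have := hc.2 hy hy' (sub_nonneg.2 hr1.le) hr0.le (by ring)
    simp only [smul_eq_mul] at this
    have e : (1 - r) • y + r • y' = x := by rw [hx]; module
    rwa [e] at this
  have hpiece : θ y' - θ x ≤ B i * ‖y' - x‖ := by
    rw [hq i y' hy'i, hq i x hri]
    have e : 1 / 2 * ⟪A i y', y'⟫ + ⟪a i, y'⟫ + α i - (1 / 2 * ⟪A i x, x⟫ + ⟪a i, x⟫ + α i)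
        = ⟪(1 / 2 : ℝ) • A i (y' + x) + a i, y' - x⟫ := by
      have h1 : ⟪A i x, y'⟫ = ⟪A i y', x⟫ := by rw [hA i x y', real_inner_comm]
      simp only [map_add, inner_add_left, inner_sub_right, inner_smul_left, h1]
      simp
      ring
    rw [e]
    refine (real_inner_le_norm _ _).trans ?_
    gcongr
    have h2 : ‖A i (y' + x)‖ ≤ ‖LinearMap.toContinuousLinearMap (A i)‖ * (R + R) := by
      refine ((LinearMap.toContinuousLinearMap (A i)).le_opNorm (y' + x)).trans ?_
      gcongr
      exact (norm_add_le _ _).trans (add_le_add hyR' hxR)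
    calc _ ≤ ‖(1 / 2 : ℝ) • A i (y' + x)‖ + ‖a i‖ := norm_add_le _ _
      _ = 1 / 2 * ‖A i (y' + x)‖ + ‖a i‖ := by rw [norm_smul]; norm_num
      _ ≤ B i := by simp only [B]; linarith
  have hBi : B i ≤ ∑ j, B j := Finset.single_le_sum (fun j _ => hB j) (Finset.mem_univ i)
  have hnx : ‖y' - x‖ = (1 - r) * ‖y' - y‖ := by
    have : y' - x = (1 - r) • (y' - y) := by rw [hx]; module
    rw [this, norm_smul, Real.norm_of_nonneg (by linarith)]
  rw [hnx] at hpiece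
  have h3 : (1 - r) * (θ y' - θ y) ≤ (1 - r) * (B i * ‖y' - y‖) := by nlinarith
  have h4 := le_of_mul_le_mul_left h3 (by linarith)
  exact h4.trans (by gcongr)

/-- Along a direction in which the subderivative is finite, a piecewise linear-quadratic
function is a quadratic polynomial. -/
theorem IsPWLQOn.ray_expansion [FiniteDimensional ℝ F] (h : IsPWLQOn D θ) {z u lam : F}
    (hlam : lam ∈ ConvexSubgrad D θ z)
    (hf : ∀ ε : ℝ, 0 < ε → ∃ᶠ p in 𝓝[>] (0 : ℝ) ×ˢ 𝓝 u,
      z + p.1 • p.2 ∈ D ∧ θ (z + p.1 • p.2) ≤ θ z + p.1 * (⟪lam, u⟫ + ε)) :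
    ∃ c : ℝ, ∀ᶠ t in 𝓝[>] (0 : ℝ), z + t • u ∈ D ∧
      θ (z + t • u) = θ z + t * ⟪lam, u⟫ + t ^ 2 / 2 * c := by
  obtain ⟨s, Ω, A, a, α, hΩ, hA, rfl, hq⟩ := h
  have hpos : ∀ᶠ p in 𝓝[>] (0 : ℝ) ×ˢ 𝓝 u, 0 < p.1 :=
    tendsto_fst.eventually self_mem_nhdsWithin
  -- With finitely many pieces, one is visited frequently for each given `ε`. It may depend on `ε`,
  -- but two quadratics that agree along the ray have equal coefficients, so the piece found for `ε
  -- = 1` has slope at most `⟪lam, u⟫ + ε` for every `ε`.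
  have key : ∀ ε : ℝ, 0 < ε → ∃ i, z ∈ Ω i ∧ (∀ᶠ t in 𝓝[>] (0 : ℝ), z + t • u ∈ Ω i) ∧
      ⟪A i z + a i, u⟫ ≤ ⟪lam, u⟫ + ε := by
    intro ε hε
    obtain ⟨i, hi⟩ : ∃ i, ∃ᶠ p in 𝓝[>] (0 : ℝ) ×ˢ 𝓝 u,
        z + p.1 • p.2 ∈ Ω i ∧ θ (z + p.1 • p.2) ≤ θ z + p.1 * (⟪lam, u⟫ + ε) := by
      by_contra hcon
      push Not at hcon
      apply hf ε hε
      have := eventually_all.2 hcon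
      filter_upwards [this] with p hp
      rintro ⟨h1, h2⟩
      obtain ⟨i, hi⟩ := Set.mem_iUnion.1 h1
      exact absurd h2 (not_le.2 (hp i hi))
    obtain ⟨hz, hray⟩ := (hΩ i).ray_mem (hi.mono fun p hp => hp.1)
    refine ⟨i, hz, hray, ?_⟩
    have hcl : IsClosed {r : ℝ | r ≤ ⟪lam, u⟫ + ε} := isClosed_Iic
    have hten : Tendsto (fun p : ℝ × F => ⟪A i z + a i, p.2⟫ + p.1 / 2 * ⟪A i p.2, p.2⟫)
        (𝓝[>] (0 : ℝ) ×ˢ 𝓝 u) (𝓝 ⟪A i z + a i, u⟫) := by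
      have hcont : Continuous fun p : ℝ × F =>
          ⟪A i z + a i, p.2⟫ + p.1 / 2 * ⟪A i p.2, p.2⟫ := by
        have := LinearMap.continuous_of_finiteDimensional (A i)
        fun_prop
      have h := hcont.tendsto ((0 : ℝ), u)
      simp only [zero_div, zero_mul, add_zero] at h
      rw [nhds_prod_eq] at h
      exact h.mono_left (prod_mono nhdsWithin_le_nhds le_rfl)
    refine hcl.mem_of_frequently_of_tendsto ?_ hten
    refine (hi.and_eventually hpos).mono ?_
    rintro ⟨t, x⟩ ⟨⟨h1, h2⟩, h0⟩
    simp only at h1 h2 h0 ⊢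
    rw [hq i _ h1, hq i _ hz, quadratic_expand (hA i)] at h2
    change ⟪A i z + a i, x⟫ + t / 2 * ⟪A i x, x⟫ ≤ ⟪lam, u⟫ + ε
    apply le_of_mul_le_mul_left _ h0
    linarith
  obtain ⟨i, hz, hray, -⟩ := key 1 one_pos
  have hexp : ∀ j, z ∈ Ω j → ∀ t : ℝ, z + t • u ∈ Ω j →
      θ (z + t • u) = θ z + t * ⟪A j z + a j, u⟫ + t ^ 2 / 2 * ⟪A j u, u⟫ := by
    intro j hzj t ht
    rw [hq j _ ht, hq j _ hzj, quadratic_expand (hA j)]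
  have hle : ⟪A i z + a i, u⟫ ≤ ⟪lam, u⟫ := by
    refine le_of_forall_pos_le_add fun ε hε => ?_
    obtain ⟨j, hzj, hrayj, hj⟩ := key ε hε
    have : ⟪A i z + a i, u⟫ = ⟪A j z + a j, u⟫ := by
      refine (coeffs_eq_of_eventually_eq (b := ⟪A i u, u⟫) (b' := ⟪A j u, u⟫) ?_).1
      filter_upwards [hray, hrayj] with t h1 h2
      have e1 := hexp i hz t h1
      have e2 := hexp j hzj t h2
      linarith
    rw [this]; exact hj
  have hge : ⟪lam, u⟫ ≤ ⟪A i z + a i, u⟫ := by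
    have hten : Tendsto (fun t : ℝ => ⟪A i z + a i, u⟫ + t / 2 * ⟪A i u, u⟫)
        (𝓝[>] (0 : ℝ)) (𝓝 (⟪A i z + a i, u⟫ + 0 / 2 * ⟪A i u, u⟫)) :=
      (Continuous.tendsto (f := fun t : ℝ => ⟪A i z + a i, u⟫ + t / 2 * ⟪A i u, u⟫)
        (by fun_prop) 0).mono_left nhdsWithin_le_nhds
    rw [zero_div, zero_mul, add_zero] at hten
    refine ge_of_tendsto hten ?_
    filter_upwards [hray, self_mem_nhdsWithin] with t h1 h0
    have h0 : (0 : ℝ) < t := h0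
    have h3 := hlam _ (Set.mem_iUnion.2 ⟨i, h1⟩)
    rw [hexp i hz t h1, add_sub_cancel_left, inner_smul_right] at h3
    apply le_of_mul_le_mul_left _ h0
    linarith
  refine ⟨⟪A i u, u⟫, ?_⟩
  filter_upwards [hray] with t ht
  refine ⟨Set.mem_iUnion.2 ⟨i, ht⟩, ?_⟩
  rw [hexp i hz t ht, le_antisymm hle hge]

/-- The second-order difference quotients of a piecewise linear-quadratic function are bounded
below, asymptotically, by its curvature along the ray. -/
theorem IsPWLQOn.second_order_lower [FiniteDimensional ℝ F] (h : IsPWLQOn D θ) {z u lam : F}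
    {c : ℝ} (hlam : lam ∈ ConvexSubgrad D θ z)
    (hray : ∀ᶠ t in 𝓝[>] (0 : ℝ), z + t • u ∈ D ∧
      θ (z + t • u) = θ z + t * ⟪lam, u⟫ + t ^ 2 / 2 * c) {c' : ℝ} (hc' : c' < c) :
    ∀ᶠ p in 𝓝[>] (0 : ℝ) ×ˢ 𝓝 u, z + p.1 • p.2 ∈ D →
      θ z + p.1 * ⟪lam, p.2⟫ + p.1 ^ 2 / 2 * c' ≤ θ (z + p.1 • p.2) := by
  obtain ⟨s, Ω, A, a, α, hΩ, hA, rfl, hq⟩ := h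
  have hpos : ∀ᶠ p in 𝓝[>] (0 : ℝ) ×ˢ 𝓝 u, 0 < p.1 :=
    tendsto_fst.eventually self_mem_nhdsWithin
  suffices H : ∀ i, ∀ᶠ p in 𝓝[>] (0 : ℝ) ×ˢ 𝓝 u, z + p.1 • p.2 ∈ Ω i →
      θ z + p.1 * ⟪lam, p.2⟫ + p.1 ^ 2 / 2 * c' ≤ θ (z + p.1 • p.2) by
    filter_upwards [eventually_all.2 H] with p hp hD
    obtain ⟨i, hi⟩ := Set.mem_iUnion.1 hD
    exact hp i hi
  intro i
  by_cases hfr : ∃ᶠ p in 𝓝[>] (0 : ℝ) ×ˢ 𝓝 u, z + p.1 • p.2 ∈ Ω i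
  swap
  · filter_upwards [not_frequently.1 hfr] with p hp hp' using absurd hp' hp
  obtain ⟨hz, hri⟩ := (hΩ i).ray_mem hfr
  have hcur : c = ⟪A i u, u⟫ := by
    refine (coeffs_eq_of_eventually_eq (a := ⟪lam, u⟫) (a' := ⟪A i z + a i, u⟫) ?_).2
    filter_upwards [hray, hri] with t h1 h2
    have e1 := h1.2
    rw [hq i _ h2, hq i _ hz, quadratic_expand (hA i)] at e1
    linarith
  have hten : Tendsto (fun p : ℝ × F => ⟪A i p.2, p.2⟫) (𝓝[>] (0 : ℝ) ×ˢ 𝓝 u) (𝓝 ⟪A i u, u⟫) := by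
    have hcont : Continuous fun x : F => ⟪A i x, x⟫ :=
      Continuous.inner (LinearMap.continuous_of_finiteDimensional _) continuous_id
    exact (hcont.tendsto u).comp tendsto_snd
  filter_upwards [hpos, hten.eventually (lt_mem_nhds (hcur ▸ hc'))] with p h0 hlt hmem
  -- The first-order term is compared in the perturbed direction `p.2` itself: the segment from `z`
  -- lies in the convex piece, so the subgradient inequality applies along it. Only the curvature
  -- term needs the limit `p.2 → u`.
  have hslope : ⟪lam, p.2⟫ ≤ ⟪A i z + a i, p.2⟫ := by
    have hten : Tendsto (fun t : ℝ => ⟪A i z + a i, p.2⟫ + t / 2 * ⟪A i p.2, p.2⟫)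
        (𝓝[>] (0 : ℝ)) (𝓝 (⟪A i z + a i, p.2⟫ + 0 / 2 * ⟪A i p.2, p.2⟫)) :=
      (Continuous.tendsto (f := fun t : ℝ => ⟪A i z + a i, p.2⟫ + t / 2 * ⟪A i p.2, p.2⟫)
        (by fun_prop) 0).mono_left nhdsWithin_le_nhds
    rw [zero_div, zero_mul, add_zero] at hten
    refine ge_of_tendsto hten ?_
    have : Set.Ioo (0 : ℝ) p.1 ∈ 𝓝[>] (0 : ℝ) := Ioo_mem_nhdsGT h0
    filter_upwards [this] with t ht
    have hm : z + t • p.2 ∈ Ω i := by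
      have := (hΩ i).convex.add_smul_sub_mem hz hmem
        ⟨div_nonneg ht.1.le h0.le, (div_le_one h0).2 ht.2.le⟩
      rwa [add_sub_cancel_left, smul_smul, div_mul_cancel₀ _ h0.ne'] at this
    have h3 := hlam _ (Set.mem_iUnion.2 ⟨i, hm⟩)
    rw [hq i _ hm, hq i _ hz, quadratic_expand (hA i), add_sub_cancel_left,
      inner_smul_right] at h3
    apply le_of_mul_le_mul_left _ ht.1
    linarith
  rw [hq i _ hmem, hq i _ hz, quadratic_expand (hA i)]
  have e1 : p.1 * ⟪lam, p.2⟫ ≤ p.1 * ⟪A i z + a i, p.2⟫ := by gcongr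
  have e2 : p.1 ^ 2 / 2 * c' ≤ p.1 ^ 2 / 2 * ⟪A i p.2, p.2⟫ := by gcongr
  linarith

end PWLQ

/-! ### Multipliers from exact penalties by separation -/

section Separation

variable {E F : Type*} [NormedAddCommGroup E] [InnerProductSpace ℝ E] [CompleteSpace E]
  [NormedAddCommGroup F] [InnerProductSpace ℝ F] [CompleteSpace F]

/-- Exact penalization turns into a bounded multiplier, by separation of convex sets. -/
theorem exists_multiplier_of_penalty {D : Set F} {θ : F → ℝ} (hc : ConvexOn ℝ D θ) {z : F}
    (hz : z ∈ D) (A : E →L[ℝ] F) (v : E) (r : F) {C μ : ℝ} (hC : 0 ≤ C)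
    (h : ∀ ρ : ℝ, 0 < ρ → ∀ y ∈ D, ∀ p : E,
      μ ≤ ρ * (θ y - θ z) - ⟪v, p⟫ + C * ‖A p + r - ρ • (y - z)‖) :
    ∃ lam : F, ‖lam‖ ≤ C ∧ ContinuousLinearMap.adjoint A lam = v ∧
      lam ∈ ConvexSubgrad D θ z ∧ μ ≤ ⟪lam, r⟫ := by
  -- `S` collects residuals together with upper bounds of the objective. The free factor `ρ` makes
  -- it convex, as for a perspective function. `T` is the open convex cone strictly below the graph
  -- of `-C ‖·‖`, and `h` says exactly that `S` avoids it.
  set S : Set (F × ℝ) := {q | ∃ ρ : ℝ, 0 < ρ ∧ ∃ y ∈ D, ∃ p : E,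
    q.1 = A p + r - ρ • (y - z) ∧ ρ * (θ y - θ z) - ⟪v, p⟫ - μ ≤ q.2}
  set T : Set (F × ℝ) := {q | q.2 < -(C * ‖q.1‖)}
  have hTo : IsOpen T := isOpen_lt (by fun_prop) (by fun_prop)
  have hTc : Convex ℝ T := by
    rintro ⟨x, s⟩ hx ⟨x', s'⟩ hx' a b ha hb hab
    simp only [T, Set.mem_ofPred_eq, Prod.fst_add, Prod.snd_add, Prod.smul_fst, Prod.smul_snd,
      smul_eq_mul] at hx hx' ⊢
    have h1 : ‖a • x + b • x'‖ ≤ a * ‖x‖ + b * ‖x'‖ := by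
      refine (norm_add_le _ _).trans_eq ?_
      rw [norm_smul, norm_smul, Real.norm_of_nonneg ha, Real.norm_of_nonneg hb]
    have h2 : C * ‖a • x + b • x'‖ ≤ C * (a * ‖x‖ + b * ‖x'‖) := by gcongr
    rcases ha.eq_or_lt with rfl | ha'
    · have : b = 1 := by linarith
      subst this
      simp only [zero_mul, one_mul, zero_add] at h2 ⊢
      linarith
    · nlinarith [mul_lt_mul_of_pos_left hx ha', mul_le_mul_of_nonneg_left hx'.le hb]
  have hSc : Convex ℝ S := by
    rintro ⟨x, s⟩ ⟨ρ, hρ, y, hy, p, hx, hs⟩ ⟨x', s'⟩ ⟨ρ', hρ', y', hy', p', hx', hs'⟩ a b ha hb hab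
    have hpos : 0 < a * ρ + b * ρ' := by
      rcases ha.eq_or_lt with rfl | ha'
      · have : b = 1 := by linarith
        subst this; simpa using hρ'
      · have := mul_pos ha' hρ
        have := mul_nonneg hb hρ'.le
        linarith
    set R := a * ρ + b * ρ' with hR
    have h1 : 0 ≤ a * ρ / R := by positivity
    have h2 : 0 ≤ b * ρ' / R := by positivity
    have h3 : a * ρ / R + b * ρ' / R = 1 := by rw [← add_div, ← hR, div_self hpos.ne']
    have e1 : R * (a * ρ / R) = a * ρ := by field_simp
    have e2 : R * (b * ρ' / R) = b * ρ' := by field_simp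
    refine ⟨R, hpos, (a * ρ / R) • y + (b * ρ' / R) • y', hc.1 hy hy' h1 h2 h3,
      a • p + b • p', ?_, ?_⟩
    · simp only [Prod.fst_add, Prod.smul_fst] at hx hx' ⊢
      have h4 : r = a • r + b • r := by rw [← add_smul, hab, one_smul]
      rw [hx, hx', smul_sub R, smul_add R, smul_smul, smul_smul, e1, e2, hR, map_add, map_smul,
        map_smul]
      conv_rhs => rw [h4]
      module
    · simp only [Prod.snd_add, Prod.smul_snd, smul_eq_mul] at hs hs' ⊢
      have h4 := hc.2 hy hy' h1 h2 h3
      simp only [smul_eq_mul] at h4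
      have h5 := mul_le_mul_of_nonneg_left h4 hpos.le
      rw [mul_add, ← mul_assoc, ← mul_assoc, e1, e2] at h5
      rw [inner_add_right, inner_smul_right, inner_smul_right]
      have h6 := mul_le_mul_of_nonneg_left hs ha
      have h7 := mul_le_mul_of_nonneg_left hs' hb
      have h8 : μ = a * μ + b * μ := by rw [← add_mul, hab, one_mul]
      have h9 : R * θ z = a * ρ * θ z + b * ρ' * θ z := by rw [hR]; ring
      linarith
  have hdisj : Disjoint T S := by
    rw [Set.disjoint_left]
    rintro ⟨x, s⟩ hT ⟨ρ, hρ, y, hy, p, hx, hs⟩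
    simp only [T, Set.mem_ofPred_eq] at hT hx hs
    have := h ρ hρ y hy p
    rw [← hx] at this
    linarith
  obtain ⟨g, c₀, hg1, hg2⟩ := geometric_hahn_banach_open hTc hTo hSc hdisj
  set β := g (0, 1) with hβdef
  have hgsplit : ∀ x s, g (x, s) = g (x, 0) + s * β := by
    intro x s
    have : ((x, s) : F × ℝ) = (x, 0) + s • (0, 1) := by ext <;> simp
    rw [this, map_add, map_smul, smul_eq_mul]
  have hS0 : ((r, -μ) : F × ℝ) ∈ S := ⟨1, one_pos, z, hz, 0, by simp, by simp⟩
  have hc0 : 0 ≤ c₀ := by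
    by_contra hcon
    push Not at hcon
    have hx : ∀ s : ℝ, 0 < s → -s * β < c₀ := fun s hs => by
      have := hg1 (0, -s) (by simp [T, hs])
      rw [hgsplit] at this
      have h0 : g ((0 : F), (0 : ℝ)) = 0 := by
        rw [show ((0 : F), (0 : ℝ)) = 0 from rfl, map_zero]
      rwa [h0, zero_add] at this
    have hβ : 0 < β := by have := hx 1 one_pos; linarith
    have := hx (-c₀ / (2 * β)) (div_pos (by linarith) (by linarith))
    have e : -(-c₀ / (2 * β)) * β = c₀ / 2 := by field_simp
    linarith
  have hscale : ∀ x s, (x, s) ∈ T → g (x, s) ≤ 0 := by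
    intro x s hxs
    by_contra hcon
    push Not at hcon
    have hk : 0 < (c₀ + 1) / g (x, s) := by positivity
    have hmem : ((c₀ + 1) / g (x, s)) • ((x, s) : F × ℝ) ∈ T := by
      simp only [T, Set.mem_ofPred_eq, Prod.smul_fst, Prod.smul_snd, smul_eq_mul] at hxs ⊢
      rw [norm_smul, Real.norm_of_nonneg hk.le]
      nlinarith [mul_lt_mul_of_pos_left hxs hk]
    have := hg1 _ hmem
    rw [map_smul, smul_eq_mul, div_mul_cancel₀ _ hcon.ne'] at this
    linarith
  have hg0 : g ((0 : F), (0 : ℝ)) = 0 := by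
    rw [show ((0 : F), (0 : ℝ)) = 0 from rfl, map_zero]
  have hβ0 : 0 ≤ β := by
    have := hscale 0 (-1) (by simp [T])
    rw [hgsplit, hg0] at this
    linarith
  -- A vertical hyperplane cannot separate: `T` projects onto all of `F`, so `g` would be
  -- nonpositive everywhere, against the strict inequality on `T` at first component `-r`.
  have hβ : 0 < β := by
    rcases hβ0.eq_or_lt with hb | hb
    · exfalso
      have hall : ∀ x s, g (x, s) ≤ 0 := fun x s => by
        have h1 := hscale x (-(C * ‖x‖) - 1) (by simp [T])
        rw [hgsplit, ← hb] at h1 ⊢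
        simpa using h1
      have h1 := hg2 _ hS0
      have h2 := hg1 (-r, -(C * ‖r‖) - 1) (by simp [T])
      rw [hgsplit, ← hb, mul_zero, add_zero] at h1 h2
      have h3 := hall r 0
      have h4 : g ((-r : F), (0 : ℝ)) = -g ((r : F), (0 : ℝ)) := by
        rw [← map_neg]; congr 1; ext <;> simp
      rw [h4] at h2
      linarith
    · exact hb
  set η : F →L[ℝ] ℝ := β⁻¹ • g.comp (ContinuousLinearMap.inl ℝ F ℝ) with hη
  set lam : F := (InnerProductSpace.toDual ℝ F).symm η with hlam
  have hin : ∀ x, ⟪lam, x⟫ = β⁻¹ * g (x, 0) := fun x => by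
    rw [hlam, InnerProductSpace.toDual_symm_apply]
    simp [hη]
  have hT' : ∀ x, ⟪lam, x⟫ ≤ C * ‖x‖ := fun x => by
    rw [hin, inv_mul_le_iff₀ hβ]
    refine le_of_forall_pos_lt_add fun ε hε => ?_
    have h1 := hscale x (-(C * ‖x‖) - ε / (2 * β)) (by
      simp only [T, Set.mem_ofPred_eq]
      have : 0 < ε / (2 * β) := by positivity
      linarith)
    rw [hgsplit, sub_mul] at h1
    have : ε / (2 * β) * β = ε / 2 := by field_simp
    rw [this] at h1
    linarith
  have hS' : ∀ ρ : ℝ, 0 < ρ → ∀ y ∈ D, ∀ p : E,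
      μ ≤ ρ * (θ y - θ z) - ⟪v, p⟫ + ⟪lam, A p + r - ρ • (y - z)⟫ := by
    intro ρ hρ y hy p
    have h1 := hg2 (A p + r - ρ • (y - z), ρ * (θ y - θ z) - ⟪v, p⟫ - μ)
      ⟨ρ, hρ, y, hy, p, rfl, le_rfl⟩
    rw [hgsplit] at h1
    rw [hin]
    have h2 : g (A p + r - ρ • (y - z), 0) =
      β * (β⁻¹ * g (A p + r - ρ • (y - z), 0)) := by field_simp
    rw [h2] at h1
    have h3 : 0 ≤ β * (β⁻¹ * g (A p + r - ρ • (y - z), 0) +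
      (ρ * (θ y - θ z) - ⟪v, p⟫ - μ)) := by linarith
    have h4 := nonneg_of_mul_nonneg_right h3 hβ
    linarith
  -- The norm bound comes from `T`. In `hS'`, scaling `p` gives the adjoint equation, large `ρ`
  -- gives the subgradient inequality, and `p = 0`, `y = z` gives the bound on `μ`.
  refine ⟨lam, ?_, ?_, ?_, ?_⟩
  · have h1 := hT' lam
    rw [real_inner_self_eq_norm_sq] at h1
    rcases (norm_nonneg lam).eq_or_lt with h0 | h0
    · rw [← h0]; exact hC
    · nlinarith
  · rw [← sub_eq_zero, ← norm_eq_zero, ← sq_eq_zero_iff, ← real_inner_self_eq_norm_sq]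
    refine le_antisymm ?_ real_inner_self_nonneg
    set d := ContinuousLinearMap.adjoint A lam - v with hd
    have h1 : 0 ≤ -⟪d, d⟫ := by
      refine nonneg_of_forall_pos_le_mul (b := μ - ⟪lam, r⟫) fun s hs => ?_
      have h2 := hS' 1 one_pos z hz (-(s • d))
      simp only [sub_self, mul_zero, smul_zero, sub_zero, inner_add_right,
        ← ContinuousLinearMap.adjoint_inner_left, inner_neg_right, inner_smul_right, zero_sub] at h2
      have h3 : ⟪d, d⟫ = ⟪ContinuousLinearMap.adjoint A lam, d⟫ - ⟪v, d⟫ := by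
        rw [← inner_sub_left]
      rw [h3]
      linarith
    linarith
  · intro y hy
    have h1 : 0 ≤ θ y - θ z - ⟪lam, y - z⟫ := by
      refine nonneg_of_forall_pos_le_mul (b := μ - ⟪lam, r⟫) fun s hs => ?_
      have h2 := hS' s hs y hy 0
      simp only [map_zero, zero_add, inner_zero_right, sub_zero, inner_sub_right,
        inner_smul_right] at h2
      rw [inner_sub_right]
      linarith
    linarith
  · simpa using hS' 1 one_pos z hz 0

end Separation

/-! ### Second-order Taylor expansions at a single point -/

section Taylor

variable {E F : Type*} [NormedAddCommGroup E] [NormedSpace ℝ E]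
  [NormedAddCommGroup F] [NormedSpace ℝ F]

/-- Second-order Taylor expansion at a point of twice differentiability. -/
theorem taylor_two {f : E → F} {x : E} (hd : ∀ᶠ y in 𝓝 x, DifferentiableAt ℝ f y)
    (h2 : DifferentiableAt ℝ (fderiv ℝ f) x) {ε : ℝ} (hε : 0 < ε) :
    ∀ᶠ h in 𝓝 (0 : E), ‖f (x + h) - f x - fderiv ℝ f x h
      - (1 / 2 : ℝ) • fderiv ℝ (fderiv ℝ f) x h h‖ ≤ ε * ‖h‖ ^ 2 := by
  have hlin := (hasFDerivAt_iff_isLittleO_nhds_zero.1 h2.hasFDerivAt).def hε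
  have hshift : Tendsto (fun h : E => x + h) (𝓝 0) (𝓝 x) := by
    have := (continuous_const_add x).tendsto (0 : E)
    rwa [add_zero] at this
  obtain ⟨δ, hδ, hball⟩ := Metric.eventually_nhds_iff_ball.1 (hlin.and (hshift.eventually hd))
  refine Metric.eventually_nhds_iff_ball.2 ⟨δ, hδ, fun h hh => ?_⟩
  have hsh : ∀ s ∈ Set.Icc (0 : ℝ) 1, s • h ∈ Metric.ball (0 : E) δ := fun s hs => by
    rw [mem_ball_zero_iff] at hh ⊢
    rw [norm_smul, Real.norm_of_nonneg hs.1]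
    exact (mul_le_of_le_one_left (norm_nonneg h) hs.2).trans_lt hh
  -- The mean value inequality is applied to the remainder along `[0, 1]`; its derivative is
  -- controlled by differentiability of `fderiv ℝ f` at `x` alone.
  set g : ℝ → F := fun s => f (x + s • h) - s • fderiv ℝ f x h
    - (s ^ 2 / 2) • fderiv ℝ (fderiv ℝ f) x h h
  have hg : ∀ s ∈ Set.Icc (0 : ℝ) 1, HasDerivWithinAt g
      (fderiv ℝ f (x + s • h) h - fderiv ℝ f x h - s • fderiv ℝ (fderiv ℝ f) x h h)
      (Set.Icc 0 1) s := by
    intro s hs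
    have h1 : HasDerivAt (fun s : ℝ => x + s • h) h s := by
      simpa using ((hasDerivAt_id s).smul_const h).const_add x
    have h3 := (hball _ (hsh s hs)).2.hasFDerivAt.comp_hasDerivAt s h1
    have h4 : HasDerivAt (fun s : ℝ => s • fderiv ℝ f x h) (fderiv ℝ f x h) s := by
      simpa using (hasDerivAt_id s).smul_const (fderiv ℝ f x h)
    have h5 : HasDerivAt (fun s : ℝ => (s ^ 2 / 2) • fderiv ℝ (fderiv ℝ f) x h h)
        (s • fderiv ℝ (fderiv ℝ f) x h h) s := by
      have h6 : HasDerivAt (fun s : ℝ => s ^ 2 / 2) s s := by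
        have := ((hasDerivAt_id s).pow 2).div_const 2
        simpa using this
      exact h6.smul_const _
    exact ((h3.sub h4).sub h5).hasDerivWithinAt
  have hbound : ∀ s ∈ Set.Ico (0 : ℝ) 1,
      ‖fderiv ℝ f (x + s • h) h - fderiv ℝ f x h - s • fderiv ℝ (fderiv ℝ f) x h h‖
        ≤ ε * ‖h‖ ^ 2 := by
    intro s hs
    have h1 := (hball _ (hsh s ⟨hs.1, hs.2.le⟩)).1
    have e : fderiv ℝ f (x + s • h) h - fderiv ℝ f x h - s • fderiv ℝ (fderiv ℝ f) x h h
        = (fderiv ℝ f (x + s • h) - fderiv ℝ f x - fderiv ℝ (fderiv ℝ f) x (s • h)) h := by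
      simp
    rw [e]
    calc _ ≤ ‖fderiv ℝ f (x + s • h) - fderiv ℝ f x - fderiv ℝ (fderiv ℝ f) x (s • h)‖ * ‖h‖ :=
          ContinuousLinearMap.le_opNorm _ _
      _ ≤ (ε * ‖s • h‖) * ‖h‖ := by gcongr
      _ ≤ (ε * ‖h‖) * ‖h‖ := by
        gcongr
        rw [norm_smul, Real.norm_of_nonneg hs.1]
        exact mul_le_of_le_one_left (norm_nonneg h) hs.2.le
      _ = ε * ‖h‖ ^ 2 := by ring
  have := norm_image_sub_le_of_norm_deriv_le_segment' hg hbound 1 (Set.right_mem_Icc.2 zero_le_one)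
  simp only [g, sub_zero, mul_one, one_smul, zero_smul, add_zero, one_pow] at this
  convert this using 2
  simp
  abel

theorem tendsto_smul_nhds_zero (u : E) :
    Tendsto (fun p : ℝ × E => p.1 • p.2) (𝓝[>] (0 : ℝ) ×ˢ 𝓝 u) (𝓝 0) := by
  have h : Tendsto (fun p : ℝ × E => p.1 • p.2) (𝓝 (0 : ℝ) ×ˢ 𝓝 u) (𝓝 ((0 : ℝ) • u)) := by
    rw [← nhds_prod_eq]
    exact Continuous.tendsto (f := fun p : ℝ × E => p.1 • p.2) (by fun_prop) (0, u)
  rw [zero_smul] at h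
  exact h.mono_left (prod_mono nhdsWithin_le_nhds le_rfl)

/-- A form of the second-order expansion suited to difference quotients: along `t ↓ 0`,
`k → u` the remainder of `f (x + t k)` is `o (t²)`. -/
theorem taylor_two_quotient {f : E → F} {x : E} (hd : ∀ᶠ y in 𝓝 x, DifferentiableAt ℝ f y)
    (h2 : DifferentiableAt ℝ (fderiv ℝ f) x) (u : E) {ε : ℝ} (hε : 0 < ε) :
    ∀ᶠ p in 𝓝[>] (0 : ℝ) ×ˢ 𝓝 u, ‖f (x + p.1 • p.2) - f x - p.1 • fderiv ℝ f x p.2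
      - (p.1 ^ 2 / 2) • fderiv ℝ (fderiv ℝ f) x u u‖ ≤ ε * p.1 ^ 2 := by
  set B := fderiv ℝ (fderiv ℝ f) x
  -- Half of `ε` pays for the Taylor remainder, with `‖p.2‖ < ‖u‖ + 1`; the other half pays for
  -- replacing `B p.2 p.2` by `B u u`.
  set ε' := ε / (2 * (‖u‖ + 1) ^ 2) with hε'
  have hε0 : 0 < ε' := by positivity
  have hsm := tendsto_smul_nhds_zero u
  have hB : Tendsto (fun p : ℝ × E => B p.2 p.2 - B u u) (𝓝[>] (0 : ℝ) ×ˢ 𝓝 u) (𝓝 0) := by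
    have hc : Continuous fun y : E => B y y - B u u := by fun_prop
    have := hc.tendsto u
    rw [sub_self] at this
    exact this.comp tendsto_snd
  have hn : ∀ᶠ p in 𝓝[>] (0 : ℝ) ×ˢ 𝓝 u, ‖p.2‖ < ‖u‖ + 1 :=
    (tendsto_snd.norm).eventually (gt_mem_nhds (lt_add_one _))
  have hBn := hB.norm.eventually (gt_mem_nhds (show ‖(0 : F)‖ < ε by simpa))
  filter_upwards [hsm.eventually (taylor_two hd h2 hε0), hn, hBn] with p h1 h3 h4
  have e : f (x + p.1 • p.2) - f x - p.1 • fderiv ℝ f x p.2 - (p.1 ^ 2 / 2) • B u u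
      = (f (x + p.1 • p.2) - f x - fderiv ℝ f x (p.1 • p.2)
        - (1 / 2 : ℝ) • B (p.1 • p.2) (p.1 • p.2)) + (p.1 ^ 2 / 2) • (B p.2 p.2 - B u u) := by
    simp only [map_smul, smul_apply]
    module
  rw [e]
  have h5 : ε' * ‖p.1 • p.2‖ ^ 2 ≤ ε / 2 * p.1 ^ 2 := by
    rw [norm_smul, mul_pow, Real.norm_eq_abs, sq_abs]
    have : ε' * (p.1 ^ 2 * ‖p.2‖ ^ 2) ≤ ε' * (p.1 ^ 2 * (‖u‖ + 1) ^ 2) := by gcongr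
    refine this.trans_eq ?_
    rw [hε']
    field_simp
  have h6 : ‖(p.1 ^ 2 / 2) • (B p.2 p.2 - B u u)‖ ≤ p.1 ^ 2 / 2 * ε := by
    rw [norm_smul, Real.norm_of_nonneg (by positivity)]
    gcongr
  calc _ ≤ _ := norm_add_le _ _
    _ ≤ ε / 2 * p.1 ^ 2 + p.1 ^ 2 / 2 * ε := add_le_add (h1.trans h5) h6
    _ = ε * p.1 ^ 2 := by ring

/-- Difference quotients of a differentiable function along `t ↓ 0`, `k → u`. -/
theorem tendsto_difference_quotient {f : E → F} {x : E} (hd : DifferentiableAt ℝ f x) (u : E) :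
    Tendsto (fun p : ℝ × E => p.1⁻¹ • (f (x + p.1 • p.2) - f x)) (𝓝[>] (0 : ℝ) ×ˢ 𝓝 u)
      (𝓝 (fderiv ℝ f x u)) := by
  refine (hasFDerivWithinAt_univ.2 hd.hasFDerivAt).lim (tendsto_smul_nhds_zero u)
    (.of_forall fun _ => Set.mem_univ _) (tendsto_snd.congr' ?_)
  have hpos : ∀ᶠ p in 𝓝[>] (0 : ℝ) ×ˢ 𝓝 u, 0 < p.1 :=
    tendsto_fst.eventually self_mem_nhdsWithin
  filter_upwards [hpos] with p hp
  rw [smul_smul, inv_mul_cancel₀ hp.ne', one_smul]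

end Taylor

/-! ### Exact penalization from metric subregularity -/

section Penalty

variable {E F : Type*} [NormedAddCommGroup E] [NormedAddCommGroup F]

/-- Local exact penalization for the constraint `f x ∈ D` and the objective `θ ∘ f`: a pair
`(x, y)` with `y ∈ D` may be replaced by `(x', f x')`, at a cost proportional to `‖f x - y‖`. -/
def PenaltyAt (D : Set F) (θ : F → ℝ) (f : E → F) (κ C : ℝ) (x : E) : Prop :=
  ∀ᶠ q in 𝓝 (x, f x), q.2 ∈ D → ∃ x' : E, f x' ∈ D ∧ ‖x' - q.1‖ ≤ κ * ‖f q.1 - q.2‖ ∧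
    θ (f x') ≤ θ q.2 + C * ‖f q.1 - q.2‖

theorem exists_pos_of_eventually_prod {P : ℝ × E → Prop} {w : E}
    (h : ∀ᶠ p in 𝓝[>] (0 : ℝ) ×ˢ 𝓝 w, P p) :
    ∃ δ > 0, ∀ t : ℝ, 0 < t → t < δ → ∀ u : E, ‖u - w‖ < δ → P (t, u) := by
  obtain ⟨pa, ha, pb, hb, hab⟩ := eventually_prod_iff.1 h
  obtain ⟨δ₁, hδ₁, h1⟩ := (nhdsGT_basis (0 : ℝ)).eventually_iff.1 ha
  obtain ⟨δ₂, hδ₂, h2⟩ := Metric.eventually_nhds_iff.1 hb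
  refine ⟨min δ₁ δ₂, lt_min hδ₁ hδ₂, fun t ht htδ u hu => hab (h1 ⟨ht, ?_⟩) (h2 ?_)⟩
  · exact htδ.trans_le (min_le_left _ _)
  · rw [dist_eq_norm]; exact hu.trans_le (min_le_right _ _)

variable [InnerProductSpace ℝ F] {D : Set F} {θ : F → ℝ} {f : E → F}

/-- Subregularity moves `q.1` to a feasible `x'` at a distance controlled by the residual. Since `f`
is Lipschitz near `x₀` and `θ` is Lipschitz on bounded parts of `D`, passing from `q.2` to `f x'`
costs a multiple of the same residual. The constants are uniform for base points near `x₀`, which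
limits of multipliers require. -/
theorem exists_penalty [FiniteDimensional ℝ F] (hD : IsPWLQOn D θ) (hc : ConvexOn ℝ D θ) {x₀ : E}
    (hf : ∃ (K : NNReal), ∃ s ∈ 𝓝 x₀, LipschitzOnWith K f s) (hx₀ : f x₀ ∈ D)
    (hm : ∃ κ : ℝ, 0 ≤ κ ∧ ∀ᶠ x in 𝓝 x₀,
      Metric.infDist x {z | f z ∈ D} ≤ κ * Metric.infDist (f x) D) :
    ∃ κ C : ℝ, 0 ≤ κ ∧ 0 ≤ C ∧ ∀ᶠ x in 𝓝 x₀, f x ∈ D → PenaltyAt D θ f κ C x := by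
  obtain ⟨K, s, hs, hK⟩ := hf
  obtain ⟨κ, hκ, hm⟩ := hm
  have hfc : ContinuousAt f x₀ := hK.continuousOn.continuousAt hs
  obtain ⟨ℓ, hℓ, hlip⟩ := hD.lipschitz hc (‖f x₀‖ + 1) (by positivity)
  refine ⟨κ + 1, ℓ * (K * (κ + 1) + 1), by positivity, by positivity, ?_⟩
  have hR : ∀ᶠ x in 𝓝 x₀, ‖f x‖ < ‖f x₀‖ + 1 := hfc.norm.eventually (gt_mem_nhds (lt_add_one _))
  obtain ⟨δ, hδ, hball⟩ := Metric.eventually_nhds_iff_ball.1 (hR.and (hm.and hs))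
  have hcont : ∀ᶠ x in 𝓝 x₀, ContinuousAt f x :=
    (eventually_mem_nhds_iff.2 hs).mono fun x hx => hK.continuousOn.continuousAt hx
  have hnear : ∀ᶠ x in 𝓝 x₀, x ∈ Metric.ball x₀ (δ / 2) := Metric.ball_mem_nhds _ (by positivity)
  filter_upwards [hcont, hnear, hR] with x hx hxδ hxR hxD
  have h1 : ∀ᶠ q in 𝓝 (x, f x), q.1 ∈ Metric.ball x₀ (δ / 2) :=
    continuousAt_fst.eventually (Metric.isOpen_ball.mem_nhds hxδ)
  have h2 : ∀ᶠ q in 𝓝 (x, f x), ‖q.2‖ < ‖f x₀‖ + 1 :=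
    (continuousAt_snd (p := (x, f x))).norm.eventually (gt_mem_nhds hxR)
  have h3 : ∀ᶠ q in 𝓝 (x, f x), (κ + 1) * ‖f q.1 - q.2‖ < δ / 2 := by
    have ht : ContinuousAt (fun q : E × F => (κ + 1) * ‖f q.1 - q.2‖) (x, f x) := by
      have : ContinuousAt (fun q : E × F => f q.1) (x, f x) :=
        ContinuousAt.comp (f := Prod.fst) (g := f) hx continuousAt_fst
      fun_prop
    refine ht.eventually (gt_mem_nhds ?_)
    simpa using hδ
  filter_upwards [h1, h2, h3] with q hq1 hq2 hq3 hqD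
  rw [Metric.mem_ball] at hq1
  -- A distance is an infimum, so an actual feasible point needs a strict inequality. The constant
  -- `κ + 1` supplies it when the residual is nonzero.
  rcases eq_or_ne (f q.1) q.2 with heq | hne
  · exact ⟨q.1, heq ▸ hqD, by simp [heq], by simp [heq]⟩
  have hpos : 0 < ‖f q.1 - q.2‖ := norm_pos_iff.2 (sub_ne_zero.2 hne)
  have hq1' := hball q.1 (by rw [Metric.mem_ball]; linarith)
  have hlt : Metric.infDist q.1 {z | f z ∈ D} < (κ + 1) * ‖f q.1 - q.2‖ := by
    refine hq1'.2.1.trans_lt ?_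
    have : Metric.infDist (f q.1) D ≤ ‖f q.1 - q.2‖ := by
      rw [← dist_eq_norm]; exact Metric.infDist_le_dist_of_mem hqD
    nlinarith [mul_le_mul_of_nonneg_left this hκ]
  obtain ⟨x', hx'D, hx'⟩ := (Metric.infDist_lt_iff ⟨x₀, hx₀⟩).1 hlt
  rw [dist_comm, dist_eq_norm] at hx'
  have hx'ball : x' ∈ Metric.ball x₀ δ := by
    rw [Metric.mem_ball]
    have := dist_triangle x' q.1 x₀
    rw [dist_eq_norm x' q.1] at this
    linarith
  have hx'' := hball x' hx'ball
  refine ⟨x', hx'D, hx'.le, ?_⟩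
  have h4 := hlip q.2 hqD (f x') hx'D hq2.le hx''.1.le
  have h5 : ‖f x' - q.2‖ ≤ (K * (κ + 1) + 1) * ‖f q.1 - q.2‖ := by
    have h6 : ‖f x' - f q.1‖ ≤ K * ‖x' - q.1‖ := hK.norm_sub_le hx''.2.2 hq1'.2.2
    have h7 : (K : ℝ) * ‖x' - q.1‖ ≤ K * ((κ + 1) * ‖f q.1 - q.2‖) := by gcongr
    have h8 : ‖f x' - q.2‖ ≤ ‖f x' - f q.1‖ + ‖f q.1 - q.2‖ :=
      norm_sub_le_norm_sub_add_norm_sub _ _ _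
    linarith
  have h6 := mul_le_mul_of_nonneg_left h5 hℓ
  linarith

end Penalty

theorem nonneg_of_forall_pos_add_mul {X M : ℝ} (h : ∀ ε : ℝ, 0 < ε → 0 ≤ X + ε * M) : 0 ≤ X := by
  have hten : Tendsto (fun ε : ℝ => X + ε * M) (𝓝[>] 0) (𝓝 (X + 0 * M)) :=
    (Continuous.tendsto (f := fun ε : ℝ => X + ε * M) (by fun_prop) 0).mono_left nhdsWithin_le_nhds
  rw [zero_mul, add_zero] at hten
  refine ge_of_tendsto hten ?_
  filter_upwards [self_mem_nhdsWithin] with ε hε using h ε hε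

/-! ### First- and second-order chain rules for the composition -/

section Composite

variable {E F : Type*} [NormedAddCommGroup E] [InnerProductSpace ℝ E]
  [NormedAddCommGroup F] [InnerProductSpace ℝ F]

/-- Second-order growth with modulus `μ` of `θ ∘ f - ⟪v, ·⟫` at `x` in the direction `w`. -/
def SecondOrderBound (D : Set F) (θ : F → ℝ) (f : E → F) (x v w : E) (μ : ℝ) : Prop :=
  ∀ᶠ p in 𝓝[>] (0 : ℝ) ×ˢ 𝓝 w, f (x + p.1 • p.2) ∈ D →
    θ (f x) + p.1 * ⟪v, p.2⟫ + p.1 ^ 2 / 2 * μ ≤ θ (f (x + p.1 • p.2))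

variable {D : Set F} {θ : F → ℝ} {f : E → F}

/-- Regular subgradients of `θ ∘ f` come from multipliers bounded by the penalty constants. -/
theorem exists_multiplier_of_regular [CompleteSpace E] [CompleteSpace F] (hc : ConvexOn ℝ D θ)
    {κ C : ℝ} (hκ : 0 ≤ κ) (hC : 0 ≤ C) {x v : E} (hx : f x ∈ D) (hf : DifferentiableAt ℝ f x)
    (hpen : PenaltyAt D θ f κ C x)
    (hv : ∀ ε : ℝ, 0 < ε → ∀ᶠ x' in 𝓝 x, f x' ∈ D →
      θ (f x) + ⟪v, x' - x⟫ - ε * ‖x' - x‖ ≤ θ (f x')) :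
    ∃ lam : F, ‖lam‖ ≤ C + ‖v‖ * κ ∧ ContinuousLinearMap.adjoint (fderiv ℝ f x) lam = v ∧
      lam ∈ ConvexSubgrad D θ (f x) := by
  -- The inequality is tested along `x + t p` and `f x + t ρ (y - f x)`, which stays in `D` by
  -- convexity. Correcting to a feasible `x'` costs `C` in `θ` and `‖v‖ κ` in the linear term, per
  -- unit of residual.
  suffices key : ∀ ρ : ℝ, 0 < ρ → ∀ y ∈ D, ∀ p : E, 0 ≤ ρ * (θ y - θ (f x)) - ⟪v, p⟫ +
      (C + ‖v‖ * κ) * ‖fderiv ℝ f x p + 0 - ρ • (y - f x)‖ by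
    obtain ⟨lam, h1, h2, h3, -⟩ := exists_multiplier_of_penalty hc hx (fderiv ℝ f x) v 0
      (by positivity) key
    exact ⟨lam, h1, h2, h3⟩
  intro ρ hρ y hy p
  set N := ‖fderiv ℝ f x p + 0 - ρ • (y - f x)‖ with hN
  have hN0 : 0 ≤ N := norm_nonneg _
  refine nonneg_of_forall_pos_add_mul (M := ‖p‖ + κ * (N + 1) + (C + ‖v‖ * κ)) fun ε' hε' => ?_
  -- The cap at `1` keeps the factor `M` in the error term independent of `ε`.
  set ε := min ε' 1 with hεdef
  have hε : 0 < ε := lt_min hε' one_pos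
  have hε1 : ε ≤ 1 := min_le_right _ _
  suffices H : 0 ≤ ρ * (θ y - θ (f x)) - ⟪v, p⟫ + (C + ‖v‖ * κ) * N +
      ε * (‖p‖ + κ * (N + 1) + (C + ‖v‖ * κ)) by
    have : ε * (‖p‖ + κ * (N + 1) + (C + ‖v‖ * κ)) ≤ ε' * (‖p‖ + κ * (N + 1) + (C + ‖v‖ * κ)) := by
      gcongr; exact min_le_left _ _
    linarith
  obtain ⟨δ, hδ, hreg⟩ := Metric.eventually_nhds_iff.1 (hv ε hε)
  have hcurve : Tendsto (fun t : ℝ => (x + t • p, f x + (t * ρ) • (y - f x))) (𝓝[>] 0)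
      (𝓝 (x, f x)) := by
    have := Continuous.tendsto (f := fun t : ℝ => (x + t • p, f x + (t * ρ) • (y - f x)))
      (by fun_prop) 0
    simp only [zero_smul, add_zero, zero_mul] at this
    exact this.mono_left nhdsWithin_le_nhds
  have hdq : ∀ᶠ t in 𝓝[>] (0 : ℝ), ‖t⁻¹ • (f (x + t • p) - f x) - ρ • (y - f x)‖ < N + ε := by
    have h1 : Tendsto (fun t : ℝ => (t, p)) (𝓝[>] 0) (𝓝[>] (0 : ℝ) ×ˢ 𝓝 p) :=
      tendsto_id.prodMk tendsto_const_nhds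
    have h2 := (((tendsto_difference_quotient hf p).comp h1).sub_const (ρ • (y - f x))).norm
    refine h2.eventually (gt_mem_nhds ?_)
    rw [hN, add_zero]
    linarith
  have hsmall : ∀ᶠ t in 𝓝[>] (0 : ℝ), t * (‖p‖ + κ * (N + 1)) < δ := by
    have := Continuous.tendsto (f := fun t : ℝ => t * (‖p‖ + κ * (N + 1))) (by fun_prop) 0
    exact (this.mono_left nhdsWithin_le_nhds).eventually (gt_mem_nhds (by simpa))
  have hle1 : ∀ᶠ t in 𝓝[>] (0 : ℝ), t * ρ < 1 := by
    have := Continuous.tendsto (f := fun t : ℝ => t * ρ) (by fun_prop) 0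
    exact (this.mono_left nhdsWithin_le_nhds).eventually (gt_mem_nhds (by simp))
  obtain ⟨t, hp, hd, hs, hl, ht⟩ := ((hcurve.eventually hpen).and (hdq.and (hsmall.and
    (hle1.and self_mem_nhdsWithin)))).exists
  have ht : 0 < t := ht
  have hyt : f x + (t * ρ) • (y - f x) ∈ D :=
    hc.1.add_smul_sub_mem hx hy ⟨by positivity, hl.le⟩
  obtain ⟨x', hx'D, hx', hθ⟩ := hp hyt
  simp only at hx' hθ
  set G := ‖f (x + t • p) - (f x + (t * ρ) • (y - f x))‖ with hG
  have hGle : G ≤ t * (N + ε) := by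
    have e : f (x + t • p) - (f x + (t * ρ) • (y - f x))
        = t • (t⁻¹ • (f (x + t • p) - f x) - ρ • (y - f x)) := by
      rw [smul_sub t, smul_smul, smul_smul, mul_inv_cancel₀ ht.ne', one_smul]; abel
    rw [hG, e, norm_smul, Real.norm_of_nonneg ht.le]
    gcongr
  have hκG : κ * G ≤ κ * (t * (N + ε)) := by gcongr
  have hCG : C * G ≤ C * (t * (N + ε)) := by gcongr
  have hdist : ‖x' - x‖ ≤ t * (‖p‖ + κ * (N + 1)) := by
    have e : x' - x = (x' - (x + t • p)) + t • p := by abel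
    have h1 : ‖x' - x‖ ≤ ‖x' - (x + t • p)‖ + ‖t • p‖ := by rw [e]; exact norm_add_le _ _
    rw [norm_smul, Real.norm_of_nonneg ht.le] at h1
    have h2 : κ * (t * (N + ε)) ≤ κ * (t * (N + 1)) := by gcongr
    linarith
  have hr := hreg (by rw [dist_eq_norm]; exact hdist.trans_lt hs) hx'D
  have hconv : θ (f x + (t * ρ) • (y - f x)) ≤ θ (f x) + t * ρ * (θ y - θ (f x)) := by
    have := hc.2 hx hy (sub_nonneg.2 hl.le) (by positivity : 0 ≤ t * ρ) (by ring)
    have e : (1 - t * ρ) • f x + (t * ρ) • y = f x + (t * ρ) • (y - f x) := by module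
    rw [e] at this
    simp only [smul_eq_mul] at this
    linarith
  have hinner : t * ⟪v, p⟫ - ‖v‖ * (κ * G) ≤ ⟪v, x' - x⟫ := by
    have e : x' - x = (x' - (x + t • p)) + t • p := by abel
    rw [e, inner_add_right, inner_smul_right]
    have h1 := (abs_le.1 (abs_real_inner_le_norm v (x' - (x + t • p)))).1
    have h2 : ‖v‖ * ‖x' - (x + t • p)‖ ≤ ‖v‖ * (κ * G) := by gcongr
    linarith
  have hvG : ‖v‖ * (κ * G) ≤ ‖v‖ * (κ * (t * (N + ε))) := by gcongr
  have hεd : ε * ‖x' - x‖ ≤ ε * (t * (‖p‖ + κ * (N + 1))) := by gcongr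
  refine nonneg_of_mul_nonneg_right (a := t) ?_ ht
  nlinarith

/-- Limits of regular subgradients of `θ ∘ f` come from multipliers. -/
theorem exists_multiplier_of_limiting [FiniteDimensional ℝ E] [FiniteDimensional ℝ F]
    (hD : IsPWLQOn D θ) (hc : ConvexOn ℝ D θ) {x₀ v₀ : E} (hx₀ : f x₀ ∈ D)
    (hd : ∀ᶠ x in 𝓝 x₀, DifferentiableAt ℝ f x) (hfd : ContinuousAt (fderiv ℝ f) x₀)
    {κ C : ℝ} (hκ : 0 ≤ κ) (hC : 0 ≤ C)
    (hpen : ∀ᶠ x in 𝓝 x₀, f x ∈ D → PenaltyAt D θ f κ C x)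
    {x v : ℕ → E} (hx : Tendsto x atTop (𝓝 x₀)) (hv : Tendsto v atTop (𝓝 v₀))
    (hreg : ∀ᶠ k in atTop, f (x k) ∈ D ∧ ∀ ε : ℝ, 0 < ε → ∀ᶠ x' in 𝓝 (x k), f x' ∈ D →
      θ (f (x k)) + ⟪v k, x' - x k⟫ - ε * ‖x' - x k‖ ≤ θ (f x')) :
    ∃ lam : F, ContinuousLinearMap.adjoint (fderiv ℝ f x₀) lam = v₀ ∧
      lam ∈ ConvexSubgrad D θ (f x₀) := by
  have : CompleteSpace E := FiniteDimensional.complete ℝ E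
  have : CompleteSpace F := FiniteDimensional.complete ℝ F
  have hfc : ContinuousAt f x₀ := hd.self_of_nhds.continuousAt
  have hvb : ∀ᶠ k in atTop, ‖v k‖ < ‖v₀‖ + 1 := hv.norm.eventually (gt_mem_nhds (lt_add_one _))
  have hex : ∀ᶠ k in atTop, ∃ lam : F, lam ∈ Metric.closedBall (0 : F) (C + (‖v₀‖ + 1) * κ) ∧
      ContinuousLinearMap.adjoint (fderiv ℝ f (x k)) lam = v k ∧
      lam ∈ ConvexSubgrad D θ (f (x k)) := by
    filter_upwards [hreg, hx.eventually hpen, hx.eventually hd, hvb] with k h1 h2 h3 h4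
    obtain ⟨lam, h5, h6, h7⟩ := exists_multiplier_of_regular hc hκ hC h1.1 h3 (h2 h1.1) h1.2
    refine ⟨lam, ?_, h6, h7⟩
    rw [mem_closedBall_zero_iff]
    have : ‖v k‖ * κ ≤ (‖v₀‖ + 1) * κ := by gcongr
    linarith
  -- Multipliers exist only for large `k`; the default value `0` elsewhere makes the choice a total
  -- sequence.
  have hex' : ∀ k, ∃ lam : F, (∃ lam : F,
      lam ∈ Metric.closedBall (0 : F) (C + (‖v₀‖ + 1) * κ) ∧
      ContinuousLinearMap.adjoint (fderiv ℝ f (x k)) lam = v k ∧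
      lam ∈ ConvexSubgrad D θ (f (x k))) → (lam ∈ Metric.closedBall (0 : F) (C + (‖v₀‖ + 1) * κ) ∧
      ContinuousLinearMap.adjoint (fderiv ℝ f (x k)) lam = v k ∧
      lam ∈ ConvexSubgrad D θ (f (x k))) := fun k => by
    by_cases h : ∃ lam : F, lam ∈ Metric.closedBall (0 : F) (C + (‖v₀‖ + 1) * κ) ∧
      ContinuousLinearMap.adjoint (fderiv ℝ f (x k)) lam = v k ∧ lam ∈ ConvexSubgrad D θ (f (x k))
    · obtain ⟨lam, hl⟩ := h
      exact ⟨lam, fun _ => hl⟩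
    · exact ⟨0, fun h' => absurd h' h⟩
  choose lam hlam using hex'
  have hL : ∀ᶠ k in atTop, lam k ∈ Metric.closedBall (0 : F) (C + (‖v₀‖ + 1) * κ) ∧
      ContinuousLinearMap.adjoint (fderiv ℝ f (x k)) (lam k) = v k ∧
      lam k ∈ ConvexSubgrad D θ (f (x k)) := hex.mono fun k hk => hlam k hk
  obtain ⟨lam₀, -, σ, hσ, hσl⟩ := (isCompact_closedBall (0 : F)
    (C + (‖v₀‖ + 1) * κ)).tendsto_subseq' (hL.mono fun k hk => hk.1).frequently
  have hσt := hσ.tendsto_atTop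
  have hxσ := hx.comp hσt
  have hLσ := hσt.eventually hL
  refine ⟨lam₀, ?_, ?_⟩
  · refine ext_inner_right ℝ fun h => ?_
    rw [ContinuousLinearMap.adjoint_inner_left]
    have h1 : Tendsto (fun k => ⟪lam (σ k), fderiv ℝ f (x (σ k)) h⟫) atTop
        (𝓝 ⟪lam₀, fderiv ℝ f x₀ h⟫) :=
      hσl.inner (((ContinuousLinearMap.apply ℝ F h).continuous.tendsto _).comp
        (hfd.tendsto.comp hxσ))
    have h2 : Tendsto (fun k => ⟪v (σ k), h⟫) atTop (𝓝 ⟪v₀, h⟫) :=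
      (hv.comp hσt).inner tendsto_const_nhds
    refine tendsto_nhds_unique (h1.congr' ?_) h2
    filter_upwards [hLσ] with k hk
    rw [← ContinuousLinearMap.adjoint_inner_left, hk.2.1]
  · intro y hy
    obtain ⟨ℓ, hℓ, hlip⟩ := hD.lipschitz hc (‖f x₀‖ + 1) (by positivity)
    have hfσ : Tendsto (fun k => f (x (σ k))) atTop (𝓝 (f x₀)) := hfc.tendsto.comp hxσ
    have h1 : Tendsto (fun k => θ (f x₀) - ℓ * ‖f x₀ - f (x (σ k))‖ +
        ⟪lam (σ k), y - f (x (σ k))⟫) atTop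
        (𝓝 (θ (f x₀) - ℓ * ‖f x₀ - f x₀‖ + ⟪lam₀, y - f x₀⟫)) :=
      ((((hfσ.const_sub (f x₀)).norm).const_mul ℓ).const_sub _).add (hσl.inner (hfσ.const_sub y))
    rw [sub_self, norm_zero, mul_zero, sub_zero] at h1
    refine le_of_tendsto h1 ?_
    filter_upwards [hLσ, hσt.eventually hreg,
      hfσ.norm.eventually (gt_mem_nhds (lt_add_one _))] with k hk hkD hkR
    have h2 := hlip _ hkD.1 _ hx₀ hkR.le (by linarith)
    have h3 := hk.2.2 y hy
    linarith

/-- The lower estimate in the second-order chain rule. -/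
theorem secondOrderBound_of_multiplier [FiniteDimensional ℝ F]
    (hD : IsPWLQOn D θ) {x v w : E} {lam : F} {c μ : ℝ}
    (hd : ∀ᶠ y in 𝓝 x, DifferentiableAt ℝ f y) (h2 : DifferentiableAt ℝ (fderiv ℝ f) x)
    (hadj : ∀ h, ⟪lam, fderiv ℝ f x h⟫ = ⟪v, h⟫) (hlam : lam ∈ ConvexSubgrad D θ (f x))
    (hray : ∀ᶠ t in 𝓝[>] (0 : ℝ), f x + t • fderiv ℝ f x w ∈ D ∧
      θ (f x + t • fderiv ℝ f x w) = θ (f x) + t * ⟪v, w⟫ + t ^ 2 / 2 * c)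
    (hμ : μ < c + ⟪lam, fderiv ℝ (fderiv ℝ f) x w w⟫) :
    SecondOrderBound D θ f x v w μ := by
  set r := fderiv ℝ (fderiv ℝ f) x w w
  -- The gap is split evenly between the curvature of `θ` and the Taylor remainder paired with
  -- `lam`.
  set ε := (c + ⟪lam, r⟫ - μ) / 2 with hεdef
  have hε : 0 < ε := by simp only [hεdef]; linarith
  rw [← hadj w] at hray
  have hlow := hD.second_order_lower hlam hray (show c - ε < c by linarith)
  have hmap : Tendsto (fun p : ℝ × E => (p.1, p.1⁻¹ • (f (x + p.1 • p.2) - f x)))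
      (𝓝[>] (0 : ℝ) ×ˢ 𝓝 w) (𝓝[>] (0 : ℝ) ×ˢ 𝓝 (fderiv ℝ f x w)) :=
    tendsto_fst.prodMk (tendsto_difference_quotient hd.self_of_nhds w)
  have hpos : ∀ᶠ p in 𝓝[>] (0 : ℝ) ×ˢ 𝓝 w, 0 < p.1 :=
    tendsto_fst.eventually self_mem_nhdsWithin
  have hε' : 0 < ε / (2 * (‖lam‖ + 1)) := by positivity
  filter_upwards [hmap.eventually hlow, hpos, taylor_two_quotient hd h2 w hε'] with p h3 h0 h4 hpD
  have e : f x + p.1 • (p.1⁻¹ • (f (x + p.1 • p.2) - f x)) = f (x + p.1 • p.2) := by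
    rw [smul_smul, mul_inv_cancel₀ h0.ne', one_smul]; abel
  simp only [e] at h3
  have h5 := h3 hpD
  rw [← inner_smul_right, smul_smul, mul_inv_cancel₀ h0.ne', one_smul] at h5
  set R := f (x + p.1 • p.2) - f x - p.1 • fderiv ℝ f x p.2 - (p.1 ^ 2 / 2) • r with hR
  have e2 : f (x + p.1 • p.2) - f x = p.1 • fderiv ℝ f x p.2 + (p.1 ^ 2 / 2) • r + R := by
    rw [hR]; abel
  rw [e2, inner_add_right, inner_add_right, inner_smul_right, inner_smul_right, hadj] at h5
  have h6 := (abs_le.1 (abs_real_inner_le_norm lam R)).1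
  have h7 : ‖lam‖ * ‖R‖ ≤ p.1 ^ 2 / 2 * ε := by
    calc ‖lam‖ * ‖R‖ ≤ (‖lam‖ + 1) * (ε / (2 * (‖lam‖ + 1)) * p.1 ^ 2) := by gcongr; linarith
      _ = p.1 ^ 2 / 2 * ε := by field_simp
  have e3 : μ = c + ⟪lam, r⟫ - 2 * ε := by rw [hεdef]; ring
  rw [e3]
  linarith

/-- The upper estimate in the second-order chain rule, with a bounded multiplier. -/
theorem exists_multiplier_of_secondOrderBound [CompleteSpace E] [CompleteSpace F]
    (hc : ConvexOn ℝ D θ) {κ C : ℝ} (hκ : 0 ≤ κ) (hC : 0 ≤ C) {x v w : E} {c μ : ℝ}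
    (hx : f x ∈ D) (hpen : PenaltyAt D θ f κ C x)
    (hd : ∀ᶠ y in 𝓝 x, DifferentiableAt ℝ f y) (h2 : DifferentiableAt ℝ (fderiv ℝ f) x)
    (hray : ∀ᶠ t in 𝓝[>] (0 : ℝ), f x + t • fderiv ℝ f x w ∈ D ∧
      θ (f x + t • fderiv ℝ f x w) = θ (f x) + t * ⟪v, w⟫ + t ^ 2 / 2 * c)
    (hμ : SecondOrderBound D θ f x v w μ) :
    ∃ lam : F, ‖lam‖ ≤ C + ‖v‖ * κ ∧ ContinuousLinearMap.adjoint (fderiv ℝ f x) lam = v ∧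
      lam ∈ ConvexSubgrad D θ (f x) ∧ μ ≤ c + ⟪lam, fderiv ℝ (fderiv ℝ f) x w w⟫ := by
  set r := fderiv ℝ (fderiv ℝ f) x w w
  set A := fderiv ℝ f x
  -- The test curves are `x + t w + t² p / 2` and `f x + t A w + (t² / 2) ρ (y - f x)`. Their
  -- residual is `t² / 2` times `A p + r - ρ (y - f x)`, up to `o(t²)`, so dividing by `t² / 2`
  -- yields the penalized inequality.
  suffices key : ∀ ρ : ℝ, 0 < ρ → ∀ y ∈ D, ∀ p : E, μ - c ≤ ρ * (θ y - θ (f x)) - ⟪v, p⟫ +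
      (C + ‖v‖ * κ) * ‖A p + r - ρ • (y - f x)‖ by
    obtain ⟨lam, h1, h2', h3, h4⟩ := exists_multiplier_of_penalty hc hx A v r
      (by positivity) key
    exact ⟨lam, h1, h2', h3, by linarith⟩
  intro ρ hρ y hy p
  set N := ‖A p + r - ρ • (y - f x)‖ with hN
  have hN0 : 0 ≤ N := norm_nonneg _
  rw [← sub_nonneg]
  refine nonneg_of_forall_pos_add_mul (M := C + ‖v‖ * κ) fun ε hε => ?_
  obtain ⟨δ, hδ, hbound⟩ := exists_pos_of_eventually_prod hμ
  have hlim0 : ∀ {g : ℝ → ℝ}, Continuous g → Tendsto g (𝓝[>] 0) (𝓝 (g 0)) := fun hg =>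
    (hg.tendsto 0).mono_left nhdsWithin_le_nhds
  have hcurve : Tendsto (fun t : ℝ => (x + t • (w + (t / 2) • p),
      f x + t • A w + (t ^ 2 / 2 * ρ) • (y - f x))) (𝓝[>] 0) (𝓝 (x, f x)) := by
    have := Continuous.tendsto (f := fun t : ℝ => (x + t • (w + (t / 2) • p),
      f x + t • A w + (t ^ 2 / 2 * ρ) • (y - f x))) (by fun_prop) 0
    norm_num only [zero_smul, add_zero, zero_mul] at this
    exact this.mono_left nhdsWithin_le_nhds
  have htay : ∀ᶠ t in 𝓝[>] (0 : ℝ), ‖f (x + t • (w + (t / 2) • p)) - f x - t • A (w + (t / 2) • p)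
      - (t ^ 2 / 2) • r‖ ≤ ε / 2 * t ^ 2 := by
    have h1 : Tendsto (fun t : ℝ => w + (t / 2) • p) (𝓝[>] 0) (𝓝 w) := by
      have := Continuous.tendsto (f := fun t : ℝ => w + (t / 2) • p) (by fun_prop) 0
      simp at this
      exact this.mono_left nhdsWithin_le_nhds
    have h3 : Tendsto (fun t : ℝ => (t, w + (t / 2) • p)) (𝓝[>] 0) (𝓝[>] (0 : ℝ) ×ˢ 𝓝 w) :=
      tendsto_id.prodMk h1
    exact h3.eventually (taylor_two_quotient hd h2 w (half_pos hε))
  have hsmall : ∀ᶠ t in 𝓝[>] (0 : ℝ), t * (‖p‖ + κ * (N + ε)) < δ :=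
    (hlim0 (by fun_prop)).eventually (gt_mem_nhds (by simpa))
  have hs1 : ∀ᶠ t in 𝓝[>] (0 : ℝ), t ^ 2 / 2 * ρ < 1 :=
    (hlim0 (by fun_prop)).eventually (gt_mem_nhds (by simp))
  have htδ : ∀ᶠ t in 𝓝[>] (0 : ℝ), t < δ := (hlim0 continuous_id).eventually (gt_mem_nhds hδ)
  -- With `s = t² ρ / 2`, the ray is evaluated at `t / (1 - s)`, so that weights `1 - s` on the ray
  -- and `s` on `y` give exactly the test point, which therefore lies in `D`.
  have hray' : ∀ᶠ t in 𝓝[>] (0 : ℝ),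
      f x + (t / (1 - t ^ 2 / 2 * ρ)) • A w ∈ D ∧
      θ (f x + (t / (1 - t ^ 2 / 2 * ρ)) • A w) = θ (f x) + t / (1 - t ^ 2 / 2 * ρ) * ⟪v, w⟫ +
        (t / (1 - t ^ 2 / 2 * ρ)) ^ 2 / 2 * c := by
    have h1 : Tendsto (fun t : ℝ => t / (1 - t ^ 2 / 2 * ρ)) (𝓝[>] 0) (𝓝[>] 0) := by
      refine tendsto_nhdsWithin_iff.2 ⟨?_, ?_⟩
      · have h3 : ContinuousAt (fun t : ℝ => t / (1 - t ^ 2 / 2 * ρ)) 0 :=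
          ContinuousAt.div (by fun_prop) (by fun_prop) (by simp)
        have h4 := h3.tendsto
        simp only [zero_div] at h4
        exact h4.mono_left nhdsWithin_le_nhds
      · filter_upwards [hs1, self_mem_nhdsWithin] with t h3 (h4 : 0 < t)
        exact div_pos h4 (by linarith)
    exact h1.eventually hray
  have hmain : ∀ᶠ t in 𝓝[>] (0 : ℝ), μ ≤ c / (1 - t ^ 2 / 2 * ρ) + ρ * (θ y - θ (f x)) - ⟪v, p⟫
      + (C + ‖v‖ * κ) * (N + ε) := by
    filter_upwards [hcurve.eventually hpen, htay, hsmall, hs1, htδ, hray', self_mem_nhdsWithin] with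
      t hp ht2 hts hs htδ' hr ht
    have ht : 0 < t := ht
    set s := t ^ 2 / 2 * ρ with hsdef
    have hs0 : 0 < s := by positivity
    have h1s : 0 < 1 - s := by linarith
    set xt := x + t • (w + (t / 2) • p) with hxt
    set yt := f x + t • A w + s • (y - f x) with hyt
    have hyte : yt = (1 - s) • (f x + (t / (1 - s)) • A w) + s • y := by
      have e : (1 - s) * (t / (1 - s)) = t := by field_simp
      rw [smul_add, smul_smul, e, hyt]
      module
    have hytD : yt ∈ D := by
      rw [hyte]; exact hc.1 hr.1 hy h1s.le hs0.le (by ring)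
    have hθyt : θ yt ≤ θ (f x) + t * ⟪v, w⟫ + t ^ 2 / 2 * (c / (1 - s)) + s * (θ y - θ (f x)) := by
      have h1 := hc.2 hr.1 hy h1s.le hs0.le (by ring)
      rw [← hyte, hr.2] at h1
      simp only [smul_eq_mul] at h1
      refine h1.trans_eq ?_
      field_simp
      ring
    obtain ⟨x', hx'D, hx', hθ⟩ := hp hytD
    set G := ‖f xt - yt‖ with hG
    have hGle : G ≤ t ^ 2 / 2 * (N + ε) := by
      have e : f xt - yt = (f xt - f x - t • A (w + (t / 2) • p) - (t ^ 2 / 2) • r)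
          + (t ^ 2 / 2) • (A p + r - ρ • (y - f x)) := by
        rw [hyt, map_add, map_smul, hsdef]
        module
      calc G ≤ ‖f xt - f x - t • A (w + (t / 2) • p) - (t ^ 2 / 2) • r‖
            + ‖(t ^ 2 / 2) • (A p + r - ρ • (y - f x))‖ := by rw [hG, e]; exact norm_add_le _ _
        _ ≤ ε / 2 * t ^ 2 + t ^ 2 / 2 * N := by
          rw [norm_smul, Real.norm_of_nonneg (by positivity)]
          gcongr
        _ = _ := by ring
    have hκG : κ * G ≤ κ * (t ^ 2 / 2 * (N + ε)) := by gcongr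
    have hCG : C * G ≤ C * (t ^ 2 / 2 * (N + ε)) := by gcongr
    -- The correction from `xt` to `x'` is of order `t²`, so the corrected direction still tends to
    -- `w` and the growth bound applies to it.
    set u' := t⁻¹ • (x' - x) with hu'
    have hxu : x + t • u' = x' := by
      rw [hu', smul_smul, mul_inv_cancel₀ ht.ne', one_smul]; abel
    have hu'w : ‖u' - w‖ < δ := by
      have e : u' - w = t⁻¹ • (x' - xt) + (t / 2) • p := by
        have e1 : x' - x = (x' - xt) + t • (w + (t / 2) • p) := by rw [hxt]; abel
        rw [hu', e1, smul_add, smul_smul, inv_mul_cancel₀ ht.ne']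
        module
      have h1 : ‖u' - w‖ ≤ t⁻¹ * ‖x' - xt‖ + t / 2 * ‖p‖ := by
        rw [e]
        refine (norm_add_le _ _).trans_eq ?_
        rw [norm_smul, norm_smul, Real.norm_of_nonneg (by positivity),
          Real.norm_of_nonneg (by positivity)]
      have h3 : t⁻¹ * ‖x' - xt‖ ≤ t / 2 * (κ * (N + ε)) := by
        rw [inv_mul_le_iff₀ ht]
        refine (hx'.trans hκG).trans_eq ?_
        ring
      have h4 : 0 ≤ t * (‖p‖ + κ * (N + ε)) := by positivity
      linarith
    have hb := hbound t ht htδ' u' hu'w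
    simp only [hxu] at hb
    have hb := hb hx'D
    rw [← inner_smul_right] at hb
    have e : t • u' = (x' - xt) + t • (w + (t / 2) • p) := by
      rw [hu', smul_smul, mul_inv_cancel₀ ht.ne', one_smul, hxt]; abel
    rw [e, inner_add_right, inner_smul_right, inner_add_right, inner_smul_right] at hb
    have h5 := (abs_le.1 (abs_real_inner_le_norm v (x' - xt))).1
    have h6 : ‖v‖ * ‖x' - xt‖ ≤ ‖v‖ * (κ * (t ^ 2 / 2 * (N + ε))) := by
      gcongr
      exact hx'.trans hκG
    have h7 : t ^ 2 / 2 * μ ≤ t ^ 2 / 2 * (c / (1 - s) + ρ * (θ y - θ (f x)) - ⟪v, p⟫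
        + (C + ‖v‖ * κ) * (N + ε)) := by
      have e5 : s * (θ y - θ (f x)) = t ^ 2 / 2 * (ρ * (θ y - θ (f x))) := by rw [hsdef]; ring
      rw [e5] at hθyt
      linarith
    exact le_of_mul_le_mul_left h7 (by positivity)
  have hten : Tendsto (fun t : ℝ => c / (1 - t ^ 2 / 2 * ρ) + ρ * (θ y - θ (f x)) - ⟪v, p⟫
      + (C + ‖v‖ * κ) * (N + ε)) (𝓝[>] 0) (𝓝 (c + ρ * (θ y - θ (f x)) - ⟪v, p⟫
      + (C + ‖v‖ * κ) * (N + ε))) := by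
    have h3 : ContinuousAt (fun t : ℝ => c / (1 - t ^ 2 / 2 * ρ)) 0 :=
      ContinuousAt.div (by fun_prop) (by fun_prop) (by simp)
    have h4 := h3.tendsto.mono_left (nhdsWithin_le_nhds (s := Set.Ioi 0))
    simp only [ne_eq, OfNat.ofNat_ne_zero, not_false_eq_true, zero_pow, zero_div, zero_mul,
      sub_zero, div_one] at h4
    exact ((h4.add_const _).sub_const _).add_const _
  have := ge_of_tendsto hten hmain
  linarith

/-- Directions in which the subderivative of `θ ∘ f` is critical admit a quadratic expansion
of `θ` along their images. -/
theorem exists_ray_of_critical [FiniteDimensional ℝ F] (hD : IsPWLQOn D θ) {x v w : E} {lam : F}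
    (hd : DifferentiableAt ℝ f x) (hadj : ∀ h, ⟪lam, fderiv ℝ f x h⟫ = ⟪v, h⟫)
    (hlam : lam ∈ ConvexSubgrad D θ (f x))
    (hw : ∀ ε : ℝ, 0 < ε → ∃ᶠ p in 𝓝[>] (0 : ℝ) ×ˢ 𝓝 w, f (x + p.1 • p.2) ∈ D ∧
      θ (f (x + p.1 • p.2)) ≤ θ (f x) + p.1 * (⟪v, w⟫ + ε)) :
    ∃ c : ℝ, ∀ᶠ t in 𝓝[>] (0 : ℝ), f x + t • fderiv ℝ f x w ∈ D ∧
      θ (f x + t • fderiv ℝ f x w) = θ (f x) + t * ⟪v, w⟫ + t ^ 2 / 2 * c := by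
  rw [← hadj w]
  refine hD.ray_expansion hlam fun ε hε => ?_
  have hmap : Tendsto (fun p : ℝ × E => (p.1, p.1⁻¹ • (f (x + p.1 • p.2) - f x)))
      (𝓝[>] (0 : ℝ) ×ˢ 𝓝 w) (𝓝[>] (0 : ℝ) ×ˢ 𝓝 (fderiv ℝ f x w)) :=
    tendsto_fst.prodMk (tendsto_difference_quotient hd w)
  have hpos : ∀ᶠ p in 𝓝[>] (0 : ℝ) ×ˢ 𝓝 w, 0 < p.1 :=
    tendsto_fst.eventually self_mem_nhdsWithin
  refine hmap.frequently (((hw ε hε).and_eventually hpos).mono ?_)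
  rintro p ⟨⟨h1, h2⟩, h0⟩
  have e : f x + p.1 • (p.1⁻¹ • (f (x + p.1 • p.2) - f x)) = f (x + p.1 • p.2) := by
    rw [smul_smul, mul_inv_cancel₀ h0.ne', one_smul]; abel
  simp only [e]
  rw [hadj w]
  exact ⟨h1, h2⟩

end Composite

/-! ### Attainment of the maximum over multipliers -/

section Growth

variable {E F : Type*} [NormedAddCommGroup E] [InnerProductSpace ℝ E]
  [NormedAddCommGroup F] [InnerProductSpace ℝ F]
  {D : Set F} {θ : F → ℝ} {f : E → F}

/-- In a critical direction the linear functional `λ ↦ ⟪λ, ∇²f(x)(w, w)⟫` attains its maximum over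
the multipliers, and the maximum controls the second-order growth from above. -/
theorem exists_maximal_multiplier [FiniteDimensional ℝ E] [FiniteDimensional ℝ F]
    (hD : IsPWLQOn D θ) (hc : ConvexOn ℝ D θ) {κ C : ℝ} (hκ : 0 ≤ κ) (hC : 0 ≤ C) {x v w : E}
    {c : ℝ} (hx : f x ∈ D) (hpen : PenaltyAt D θ f κ C x)
    (hd : ∀ᶠ y in 𝓝 x, DifferentiableAt ℝ f y) (h2 : DifferentiableAt ℝ (fderiv ℝ f) x)
    (hray : ∀ᶠ t in 𝓝[>] (0 : ℝ), f x + t • fderiv ℝ f x w ∈ D ∧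
      θ (f x + t • fderiv ℝ f x w) = θ (f x) + t * ⟪v, w⟫ + t ^ 2 / 2 * c)
    {lam₀ : F} (hadj₀ : ∀ h, ⟪lam₀, fderiv ℝ f x h⟫ = ⟪v, h⟫)
    (hlam₀ : lam₀ ∈ ConvexSubgrad D θ (f x)) :
    ∃ lam₁ : F, (∀ h, ⟪lam₁, fderiv ℝ f x h⟫ = ⟪v, h⟫) ∧ lam₁ ∈ ConvexSubgrad D θ (f x) ∧
      (∀ lam : F, (∀ h, ⟪lam, fderiv ℝ f x h⟫ = ⟪v, h⟫) → lam ∈ ConvexSubgrad D θ (f x) →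
        ⟪lam, fderiv ℝ (fderiv ℝ f) x w w⟫ ≤ ⟪lam₁, fderiv ℝ (fderiv ℝ f) x w w⟫) ∧
      ∀ μ, SecondOrderBound D θ f x v w μ →
        μ ≤ c + ⟪lam₁, fderiv ℝ (fderiv ℝ f) x w w⟫ := by
  have : CompleteSpace E := FiniteDimensional.complete ℝ E
  have : CompleteSpace F := FiniteDimensional.complete ℝ F
  set r := fderiv ℝ (fderiv ℝ f) x w w
  -- This is the compact set of multipliers within the penalty bound; the full multiplier set may be
  -- unbounded.
  set S : Set F := Metric.closedBall 0 (C + ‖v‖ * κ) ∩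
    ({lam | ∀ h, ⟪lam, fderiv ℝ f x h⟫ = ⟪v, h⟫} ∩ ConvexSubgrad D θ (f x))
  have hS : IsCompact S := by
    refine (isCompact_closedBall _ _).inter_right (IsClosed.inter ?_ ?_)
    · simp only [Set.ofPred_forall]
      exact isClosed_iInter fun h => isClosed_eq (by fun_prop) continuous_const
    · simp only [ConvexSubgrad, Set.ofPred_forall]
      exact isClosed_iInter fun y => isClosed_iInter fun _ =>
        isClosed_le (by fun_prop) continuous_const
  have hup : ∀ μ, SecondOrderBound D θ f x v w μ → ∃ lam ∈ S, μ ≤ c + ⟪lam, r⟫ := by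
    intro μ hμ
    obtain ⟨lam, h1, h3, h4, h5⟩ :=
      exists_multiplier_of_secondOrderBound hc hκ hC hx hpen hd h2 hray hμ
    refine ⟨lam, ⟨mem_closedBall_zero_iff.2 h1, fun h => ?_, h4⟩, h5⟩
    rw [← ContinuousLinearMap.adjoint_inner_left, h3]
  have hlow : ∀ lam : F, (∀ h, ⟪lam, fderiv ℝ f x h⟫ = ⟪v, h⟫) → lam ∈ ConvexSubgrad D θ (f x) →
      ∀ μ, μ < c + ⟪lam, r⟫ → SecondOrderBound D θ f x v w μ := fun lam h1 h3 μ hμ =>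
    secondOrderBound_of_multiplier hD hd h2 h1 h3 hray hμ
  have hne : S.Nonempty := by
    obtain ⟨lam, hl, -⟩ := hup _ (hlow lam₀ hadj₀ hlam₀ (c + ⟪lam₀, r⟫ - 1) (by linarith))
    exact ⟨lam, hl⟩
  obtain ⟨lam₁, hl₁, hmax⟩ := hS.exists_isMaxOn hne
    (f := fun lam => ⟪lam, r⟫) (Continuous.continuousOn (by fun_prop))
  have hb : ∀ μ, SecondOrderBound D θ f x v w μ → μ ≤ c + ⟪lam₁, r⟫ := fun μ hμ => by
    obtain ⟨lam, hl, h1⟩ := hup μ hμ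
    have : ⟪lam, r⟫ ≤ ⟪lam₁, r⟫ := hmax hl
    linarith
  refine ⟨lam₁, hl₁.2.1, hl₁.2.2, fun lam h1 h3 => ?_, hb⟩
  -- Any multiplier, however large, yields lower growth bounds, and each of these is in turn
  -- dominated by a multiplier in the ball. So the maximum over the ball is global.
  refine le_of_forall_lt fun a ha => ?_
  obtain ⟨a', h4, h5⟩ := exists_between ha
  have := hb (c + a') (hlow lam h1 h3 _ (by linarith))
  linarith

end Growth

/-! ### Adding the smooth term, and uniformity over directions -/

section Shift

variable {E F : Type*} [NormedAddCommGroup E] [InnerProductSpace ℝ E]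
  {D : Set F} {θ : F → ℝ} {f : E → F}

/-- Adding a twice differentiable function shifts the second-order growth by its Hessian. -/
theorem secondOrderBound_of_growth {φ₀ : E → ℝ} {x v w : E}
    (hφ₀ : TwiceDifferentiableAt φ₀ x) (hv : ∀ h, fderiv ℝ φ₀ x h = -⟪v, h⟫)
    {μ μ' : ℝ} (hμ : μ' < μ)
    (h : ∀ᶠ p in 𝓝[>] (0 : ℝ) ×ˢ 𝓝 w, f (x + p.1 • p.2) ∈ D →
      φ₀ x + θ (f x) + p.1 ^ 2 / 2 * μ ≤ φ₀ (x + p.1 • p.2) + θ (f (x + p.1 • p.2))) :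
    SecondOrderBound D θ f x v w (μ' - fderiv ℝ (fderiv ℝ φ₀) x w w) := by
  filter_upwards [h, taylor_two_quotient hφ₀.1 hφ₀.2 w (ε := (μ - μ') / 2) (by linarith)] with
    p h1 h2 hD
  have h3 := h1 hD
  rw [Real.norm_eq_abs, abs_le, hv] at h2
  simp only [smul_eq_mul] at h2
  linarith [h2.2]

theorem growth_of_secondOrderBound {φ₀ : E → ℝ} {x v w : E}
    (hφ₀ : TwiceDifferentiableAt φ₀ x) (hv : ∀ h, fderiv ℝ φ₀ x h = -⟪v, h⟫)
    {μ μ' : ℝ} (hμ : μ' < μ)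
    (h : SecondOrderBound D θ f x v w (μ - fderiv ℝ (fderiv ℝ φ₀) x w w)) :
    ∀ᶠ p in 𝓝[>] (0 : ℝ) ×ˢ 𝓝 w, f (x + p.1 • p.2) ∈ D →
      φ₀ x + θ (f x) + p.1 ^ 2 / 2 * μ' ≤ φ₀ (x + p.1 • p.2) + θ (f (x + p.1 • p.2)) := by
  filter_upwards [h, taylor_two_quotient hφ₀.1 hφ₀.2 w (ε := (μ - μ') / 2) (by linarith)] with
    p h1 h2 hD
  have h3 := h1 hD
  rw [Real.norm_eq_abs, abs_le, hv] at h2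
  simp only [smul_eq_mul] at h2
  linarith [h2.1]

end Shift

/-- Directional second-order growth in all nonzero directions is uniform. -/
theorem quadratic_growth_of_directional {E : Type*} [NormedAddCommGroup E] [NormedSpace ℝ E]
    [FiniteDimensional ℝ E] {S : Set E} {g : E → ℝ} {x : E}
    (h : ∀ w : E, w ≠ 0 → ∃ μ : ℝ, 0 < μ ∧ ∀ᶠ p in 𝓝[>] (0 : ℝ) ×ˢ 𝓝 w, x + p.1 • p.2 ∈ S →
      g x + p.1 ^ 2 / 2 * μ ≤ g (x + p.1 • p.2)) :
    ∃ ℓ : ℝ, 0 < ℓ ∧ ∃ ε : ℝ, 0 < ε ∧ ∀ y ∈ Metric.closedBall x ε, y ∈ S →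
      g x + ℓ * ‖y - x‖ ^ 2 ≤ g y := by
  have key : ∃ ℓ : ℝ, 0 < ℓ ∧ ∃ δ : ℝ, 0 < δ ∧ ∀ t : ℝ, 0 < t → t < δ →
      ∀ u ∈ Metric.sphere (0 : E) 1, x + t • u ∈ S → g x + t ^ 2 * ℓ ≤ g (x + t • u) := by
    -- Each direction has a neighbourhood with its own modulus and step bound; a finite subcover of
    -- the sphere gives positive minima.
    refine IsCompact.induction_on (p := fun U : Set E => ∃ ℓ : ℝ, 0 < ℓ ∧ ∃ δ : ℝ, 0 < δ ∧
      ∀ t : ℝ, 0 < t → t < δ → ∀ u ∈ U, x + t • u ∈ S → g x + t ^ 2 * ℓ ≤ g (x + t • u))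
      (isCompact_sphere (0 : E) 1) ?_ ?_ ?_ ?_
    · exact ⟨1, one_pos, 1, one_pos, fun t _ _ u hu => absurd hu (Set.notMem_empty u)⟩
    · rintro s t hst ⟨ℓ, hℓ, δ, hδ, H⟩
      exact ⟨ℓ, hℓ, δ, hδ, fun r h0 h1 u hu => H r h0 h1 u (hst hu)⟩
    · rintro s s' ⟨ℓ, hℓ, δ, hδ, H⟩ ⟨ℓ', hℓ', δ', hδ', H'⟩
      refine ⟨min ℓ ℓ', lt_min hℓ hℓ', min δ δ', lt_min hδ hδ', fun t h0 h1 u hu hS => ?_⟩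
      rcases hu with hu | hu
      · have h3 := H t h0 (h1.trans_le (min_le_left _ _)) u hu hS
        have : t ^ 2 * min ℓ ℓ' ≤ t ^ 2 * ℓ := by gcongr; exact min_le_left _ _
        linarith
      · have h3 := H' t h0 (h1.trans_le (min_le_right _ _)) u hu hS
        have : t ^ 2 * min ℓ ℓ' ≤ t ^ 2 * ℓ' := by gcongr; exact min_le_right _ _
        linarith
    · intro w hw
      have hw0 : w ≠ 0 := by
        rintro rfl
        simp at hw
      obtain ⟨μ, hμ, hev⟩ := h w hw0
      obtain ⟨δ, hδ, H⟩ := exists_pos_of_eventually_prod hev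
      refine ⟨Metric.ball w δ, mem_nhdsWithin_of_mem_nhds (Metric.ball_mem_nhds w hδ),
        μ / 2, by positivity, δ, hδ, fun t h0 h1 u hu hS => ?_⟩
      have := H t h0 h1 u (by rwa [Metric.mem_ball, dist_eq_norm] at hu) hS
      simp only at this
      linarith
  obtain ⟨ℓ, hℓ, δ, hδ, H⟩ := key
  refine ⟨ℓ, hℓ, δ / 2, by positivity, fun y hy hS => ?_⟩
  rw [mem_closedBall_iff_norm] at hy
  rcases eq_or_ne y x with rfl | hne
  · simp
  have hpos : 0 < ‖y - x‖ := norm_pos_iff.2 (sub_ne_zero.2 hne)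
  have e : x + ‖y - x‖ • (‖y - x‖⁻¹ • (y - x)) = y := by
    rw [smul_smul, mul_inv_cancel₀ hpos.ne', one_smul]; abel
  have := H ‖y - x‖ hpos (by linarith) (‖y - x‖⁻¹ • (y - x)) (by
    rw [mem_sphere_zero_iff_norm, norm_smul, norm_inv, norm_norm, inv_mul_cancel₀ hpos.ne'])
    (by rwa [e])
  rw [e] at this
  linarith

theorem norm_toLp_prod_le {E : Type*} [NormedAddCommGroup E] (a : E) (b : ℝ) :
    ‖WithLp.toLp 2 (a, b)‖ ≤ ‖a‖ + |b| := by
  rw [WithLp.prod_norm_eq_of_L2]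
  refine Real.sqrt_le_iff.2 ⟨by positivity, ?_⟩
  change ‖a‖ ^ 2 + |b| ^ 2 ≤ _
  nlinarith [mul_nonneg (norm_nonneg a) (abs_nonneg b)]

/-! ### From normals to subgradients -/

section Normals

variable {E : Type*} [NormedAddCommGroup E] [InnerProductSpace ℝ E]

/-- Limiting normals to convex sets are normals in the sense of convex analysis. -/
theorem inner_le_zero_of_limitingNormal {Ω : Set E} (hΩ : Convex ℝ Ω) {x₀ u : E}
    (hu : u ∈ limitingNormalCone Ω x₀) {x : E} (hx : x ∈ Ω) : ⟪u, x - x₀⟫ ≤ 0 := by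
  obtain ⟨xs, us, hxs, hxlim, hulim, hreg⟩ := hu
  have hk : ∀ k, ⟪us k, x - xs k⟫ ≤ 0 := by
    intro k
    have h1 : 0 ≤ -⟪us k, x - xs k⟫ := by
      refine nonneg_of_forall_pos_add_mul (M := ‖x - xs k‖) fun ε hε => ?_
      have ht : Tendsto (fun t : ℝ => xs k + t • (x - xs k)) (𝓝[>] 0) (𝓝[Ω] (xs k)) := by
        refine tendsto_nhdsWithin_iff.2 ⟨?_, ?_⟩
        · have := Continuous.tendsto (f := fun t : ℝ => xs k + t • (x - xs k)) (by fun_prop) 0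
          rw [zero_smul, add_zero] at this
          exact this.mono_left nhdsWithin_le_nhds
        · have : Set.Ioo (0 : ℝ) 1 ∈ 𝓝[>] (0 : ℝ) := Ioo_mem_nhdsGT one_pos
          filter_upwards [this] with t ht
          exact hΩ.add_smul_sub_mem (hxs k) hx ⟨ht.1.le, ht.2.le⟩
      obtain ⟨t, h2, h0⟩ := ((ht.eventually (hreg k ε hε)).and self_mem_nhdsWithin).exists
      have h0 : 0 < t := h0
      rw [add_sub_cancel_left, inner_smul_right, norm_smul, Real.norm_of_nonneg h0.le] at h2
      have h3 : t * ⟪us k, x - xs k⟫ ≤ t * (ε * ‖x - xs k‖) := by linarith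
      have := le_of_mul_le_mul_left h3 h0
      linarith
    linarith
  exact le_of_tendsto (hulim.inner (hxlim.const_sub x)) (.of_forall hk)

/-- A non-horizontal regular normal to the epigraph of a function that is Lipschitz on its domain
gives a regular subgradient. -/
theorem regular_subgradient_of_normal {φ : E → EReal} (hbot : ∀ x, φ x ≠ ⊥)
    {X u : WithLp 2 (E × ℝ)} (hX : X ∈ epi φ) (hu : u ∈ regularNormalCone (epi φ) X)
    (hneg : u.snd < 0) {M : ℝ} (hM : 0 ≤ M)
    (hlip : ∀ᶠ x in 𝓝 X.fst, x ∈ dom φ → |(φ x).toReal - (φ X.fst).toReal| ≤ M * ‖x - X.fst‖)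
    {ε : ℝ} (hε : 0 < ε) :
    ∀ᶠ x in 𝓝 X.fst, x ∈ dom φ →
      (φ X.fst).toReal + ⟪(-u.snd)⁻¹ • u.fst, x - X.fst⟫ - ε * ‖x - X.fst‖ ≤ (φ x).toReal := by
  have hβ : 0 < -u.snd := by linarith
  set β := -u.snd with hβdef
  have hε' : 0 < ε * β / (1 + M) := by positivity
  obtain ⟨δ, hδ, hreg⟩ := Metric.mem_nhdsWithin_iff.1 (hu _ hε')
  have hsm : ∀ᶠ x in 𝓝 X.fst, (1 + M) * ‖x - X.fst‖ < δ := by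
    have := Continuous.tendsto (f := fun x : E => (1 + M) * ‖x - X.fst‖) (by fun_prop) X.fst
    exact this.eventually (gt_mem_nhds (by simpa))
  filter_upwards [hlip, hsm] with x hl hs hx
  have hl := hl hx
  set d := (φ x).toReal - (φ X.fst).toReal with hd
  -- The base point `X` may lie strictly above the graph. Shifting its height by the increment `d`
  -- stays in the epigraph, and the Lipschitz bound keeps `‖Y - X‖` comparable to `‖x - X.fst‖`.
  set Y : WithLp 2 (E × ℝ) := WithLp.toLp 2 (x, X.snd + d) with hY
  have hYX : Y - X = WithLp.toLp 2 (x - X.fst, d) := by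
    apply (WithLp.equiv 2 (E × ℝ)).injective
    ext
    · simp [hY]
    · simp [hY]
  have hXle : φ X.fst ≤ (X.snd : EReal) := hX
  have hXtop : φ X.fst ≠ ⊤ := ne_top_of_le_ne_top (EReal.coe_ne_top _) hXle
  have hXle' : (φ X.fst).toReal ≤ X.snd := by
    rw [← EReal.coe_toReal hXtop (hbot _)] at hXle
    exact_mod_cast hXle
  have hYepi : Y ∈ epi φ := by
    change φ x ≤ ((X.snd + d : ℝ) : EReal)
    rw [← EReal.coe_toReal (ne_of_lt hx) (hbot x), EReal.coe_le_coe_iff]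
    linarith
  have hnorm : ‖Y - X‖ ≤ (1 + M) * ‖x - X.fst‖ := by
    rw [hYX]
    refine (norm_toLp_prod_le _ _).trans ?_
    linarith
  have h1 : ⟪u, Y - X⟫ ≤ ε * β / (1 + M) * ‖Y - X‖ :=
    hreg ⟨by rw [Metric.mem_ball, dist_eq_norm]; exact hnorm.trans_lt hs, hYepi⟩
  have h2 : ε * β / (1 + M) * ‖Y - X‖ ≤ β * (ε * ‖x - X.fst‖) := by
    calc _ ≤ ε * β / (1 + M) * ((1 + M) * ‖x - X.fst‖) := by gcongr
      _ = _ := by field_simp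
  have h3 : ⟪u, Y - X⟫ = ⟪u.fst, x - X.fst⟫ - β * d := by
    rw [hYX, WithLp.prod_inner_apply]
    simp [hβdef]
    ring
  rw [inner_smul_left]
  have h4 : ⟪u.fst, x - X.fst⟫ = β * (β⁻¹ * ⟪u.fst, x - X.fst⟫) := by field_simp
  simp only [conj_trivial]
  have h5 : β * (β⁻¹ * ⟪u.fst, x - X.fst⟫) ≤ β * (d + ε * ‖x - X.fst‖) := by
    rw [← h4]; linarith
  have := le_of_mul_le_mul_left h5 hβ
  linarith

end Normals

/-! ### Extended-real functions and their finite parts -/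

section ExtendedReal

theorem ereal_quotient_lt_iff {y : EReal} (hy : y ≠ ⊥) (a b c : ℝ) {t : ℝ} (ht : 0 < t) :
    (y - (a : EReal) - (b : EReal)) / (t : EReal) < (c : EReal) ↔
      y < ⊤ ∧ y.toReal < a + b + t * c := by
  induction y with
  | bot => exact absurd rfl hy
  | top =>
    rw [EReal.top_sub_coe, EReal.top_sub_coe, EReal.top_div_of_pos_ne_top (by exact_mod_cast ht)
      (EReal.coe_ne_top t)]
    simp
  | coe r =>
    rw [← EReal.coe_sub, ← EReal.coe_sub, ← EReal.coe_div, EReal.coe_lt_coe_iff, div_lt_iff₀ ht]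
    simp only [EReal.coe_lt_top, EReal.toReal_coe, true_and]
    constructor <;> intro h <;> linarith

theorem ereal_quotient_lt_iff' {y : EReal} (hy : y ≠ ⊥) (a c : ℝ) {t : ℝ} (ht : 0 < t) :
    (y - (a : EReal)) / (t : EReal) < (c : EReal) ↔ y < ⊤ ∧ y.toReal < a + t * c := by
  have := ereal_quotient_lt_iff hy a 0 c ht
  simpa using this

theorem coe_toReal_of_mem_dom {F : Type*} {ϑ : F → EReal} (hbot : ∀ y, ϑ y ≠ ⊥) {y : F}
    (hy : y ∈ dom ϑ) : ((ϑ y).toReal : EReal) = ϑ y := EReal.coe_toReal (ne_of_lt hy) (hbot y)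

theorem toLp_mem_epi {F : Type*} {ϑ : F → EReal} (hbot : ∀ y, ϑ y ≠ ⊥) {y : F}
    (hy : y ∈ dom ϑ) :
    WithLp.toLp 2 (y, (ϑ y).toReal) ∈ epi ϑ := by
  change ϑ y ≤ ((ϑ y).toReal : EReal)
  rw [coe_toReal_of_mem_dom hbot hy]

variable {F : Type*} [NormedAddCommGroup F] [InnerProductSpace ℝ F] {ϑ : F → EReal}

theorem IsPWLQ.isPWLQOn (h : IsPWLQ ϑ) : IsPWLQOn (dom ϑ) (fun y => (ϑ y).toReal) := by
  obtain ⟨-, s, Ω, A, a, α, h1, h2, h3, h4⟩ := h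
  refine ⟨s, Ω, A, a, α, h1, h2, h3, fun i x hx => ?_⟩
  simp only [h4 i x hx, EReal.toReal_coe]

theorem IsConvexFun.convexOn (h : IsConvexFun ϑ) (hbot : ∀ y, ϑ y ≠ ⊥) :
    ConvexOn ℝ (dom ϑ) (fun y => (ϑ y).toReal) := by
  have key : ∀ y ∈ dom ϑ, ∀ y' ∈ dom ϑ, ∀ a b : ℝ, 0 ≤ a → 0 ≤ b → a + b = 1 →
      ϑ (a • y + b • y') ≤ ((a * (ϑ y).toReal + b * (ϑ y').toReal : ℝ) : EReal) :=
    fun y hy y' hy' a b ha hb hab =>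
      h (toLp_mem_epi hbot hy) (toLp_mem_epi hbot hy') ha hb hab
  have hdom : ∀ y ∈ dom ϑ, ∀ y' ∈ dom ϑ, ∀ a b : ℝ, 0 ≤ a → 0 ≤ b → a + b = 1 →
      a • y + b • y' ∈ dom ϑ := fun y hy y' hy' a b ha hb hab =>
    (key y hy y' hy' a b ha hb hab).trans_lt (EReal.coe_lt_top _)
  refine ⟨fun y hy y' hy' a b ha hb hab => hdom y hy y' hy' a b ha hb hab,
    fun y hy y' hy' a b ha hb hab => ?_⟩
  have h1 := key y hy y' hy' a b ha hb hab
  rw [← coe_toReal_of_mem_dom hbot (hdom y hy y' hy' a b ha hb hab), EReal.coe_le_coe_iff] at h1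
  exact h1

/-- The limiting subdifferential of a convex function is its convex subdifferential. -/
theorem mem_limitingSubdiff_iff (h : IsConvexFun ϑ) (hbot : ∀ y, ϑ y ≠ ⊥) {z : F}
    (hz : z ∈ dom ϑ) {lam : F} :
    lam ∈ limitingSubdiff ϑ z ↔ lam ∈ ConvexSubgrad (dom ϑ) (fun y => (ϑ y).toReal) z := by
  constructor
  · rintro ⟨-, hl⟩ y hy
    have := inner_le_zero_of_limitingNormal h hl (toLp_mem_epi hbot hy)
    rw [WithLp.prod_inner_apply] at this
    simp at this
    simp only
    linarith
  · intro hl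
    refine ⟨hz, fun _ => WithLp.toLp 2 (z, (ϑ z).toReal), fun _ => WithLp.toLp 2 (lam, -1),
      fun _ => toLp_mem_epi hbot hz, tendsto_const_nhds, tendsto_const_nhds, fun _ ε hε => ?_⟩
    filter_upwards [self_mem_nhdsWithin] with X hX
    refine le_trans ?_ (by positivity : 0 ≤ ε * ‖X - WithLp.toLp 2 (z, (ϑ z).toReal)‖)
    have hXle : ϑ X.fst ≤ (X.snd : EReal) := hX
    have hXd : X.fst ∈ dom ϑ := hXle.trans_lt (EReal.coe_lt_top _)
    rw [← coe_toReal_of_mem_dom hbot hXd, EReal.coe_le_coe_iff] at hXle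
    have h1 := hl _ hXd
    rw [WithLp.prod_inner_apply]
    simp
    simp only at h1
    linarith

/-- The second subderivative of a convex piecewise linear-quadratic function in a direction along
which the function is quadratic. -/
theorem secondSubderiv_eq_of_ray [FiniteDimensional ℝ F] (h : IsPWLQ ϑ) {z u lam : F}
    (hz : z ∈ dom ϑ)
    (hlam : lam ∈ ConvexSubgrad (dom ϑ) (fun y => (ϑ y).toReal) z) {c : ℝ}
    (hray : ∀ᶠ t in 𝓝[>] (0 : ℝ), z + t • u ∈ dom ϑ ∧
      (ϑ (z + t • u)).toReal = (ϑ z).toReal + t * ⟪lam, u⟫ + t ^ 2 / 2 * c) :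
    secondSubderiv ϑ z lam u = (c : EReal) := by
  have hpos : ∀ᶠ p in 𝓝[>] (0 : ℝ) ×ˢ 𝓝 u, 0 < p.1 :=
    tendsto_fst.eventually self_mem_nhdsWithin
  rw [secondSubderiv, ← coe_toReal_of_mem_dom h.1 hz]
  -- The exact ray suffices for the upper bound on a liminf; the lower bound needs all nearby
  -- directions, through `IsPWLQOn.second_order_lower`.
  apply le_antisymm
  · refine EReal.le_of_forall_lt_iff_le.1 fun b hb => ?_
    have hb : c < b := by exact_mod_cast hb
    refine liminf_le_of_frequently_le' ?_
    have ht : Tendsto (fun t : ℝ => (t, u)) (𝓝[>] 0) (𝓝[>] (0 : ℝ) ×ˢ 𝓝 u) :=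
      tendsto_id.prodMk tendsto_const_nhds
    refine ht.frequently (Eventually.frequently ?_)
    filter_upwards [hray, self_mem_nhdsWithin] with t h1 (h0 : 0 < t)
    refine le_of_lt ((ereal_quotient_lt_iff (h.1 _) _ _ _ (by positivity)).2 ⟨h1.1, ?_⟩)
    rw [h1.2]
    have : t ^ 2 / 2 * c < t ^ 2 / 2 * b := by gcongr
    linarith
  · refine EReal.ge_of_forall_gt_iff_ge.1 fun b hb => ?_
    have hb : b < c := by exact_mod_cast hb
    refine le_liminf_of_le ?_ ?_
    · isBoundedDefault
    filter_upwards [h.isPWLQOn.second_order_lower hlam hray hb, hpos] with p h1 h0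
    rw [← not_lt, ereal_quotient_lt_iff (h.1 _) _ _ _ (by positivity)]
    rintro ⟨h2, h3⟩
    have := h1 h2
    linarith

end ExtendedReal

/-- Supplies the relative Lipschitz estimate that turns epigraphical normals into regular
subgradients, with one constant for all base points near `x₀`. -/
theorem exists_lipschitz_comp {E F : Type*} [NormedAddCommGroup E] [NormedAddCommGroup F]
    [InnerProductSpace ℝ F] {f : E → F} {D : Set F} {θ : F → ℝ} [FiniteDimensional ℝ F]
    (hD : IsPWLQOn D θ) (hc : ConvexOn ℝ D θ) {x₀ : E}
    (hf : ∃ (K : NNReal), ∃ s ∈ 𝓝 x₀, LipschitzOnWith K f s) :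
    ∃ M : ℝ, 0 ≤ M ∧ ∀ᶠ x in 𝓝 x₀, f x ∈ D → ∀ᶠ x' in 𝓝 x, f x' ∈ D →
      |θ (f x') - θ (f x)| ≤ M * ‖x' - x‖ := by
  obtain ⟨K, s, hs, hK⟩ := hf
  have hfc : ContinuousAt f x₀ := hK.continuousOn.continuousAt hs
  obtain ⟨ℓ, hℓ, hlip⟩ := hD.lipschitz hc (‖f x₀‖ + 1) (by positivity)
  have hR : ∀ᶠ x in 𝓝 x₀, ‖f x‖ < ‖f x₀‖ + 1 := hfc.norm.eventually (gt_mem_nhds (lt_add_one _))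
  refine ⟨ℓ * K, by positivity, ?_⟩
  filter_upwards [(hR.and hs).eventually_nhds] with x hx hxD
  filter_upwards [hx] with x' hx' hx'D
  have hx := hx.self_of_nhds
  have h1 := hlip _ hxD _ hx'D hx.1.le hx'.1.le
  have h2 := hlip _ hx'D _ hxD hx'.1.le hx.1.le
  rw [norm_sub_rev] at h2
  have h3 : ℓ * ‖f x' - f x‖ ≤ ℓ * (K * ‖x' - x‖) := by
    gcongr
    exact hK.norm_sub_le hx'.2 hx.2
  rw [abs_le]
  constructor <;> linarith

theorem frequently_of_mem_criticalCone {E F : Type*} [NormedAddCommGroup E]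
    [InnerProductSpace ℝ E] {ϑ : F → EReal} {f : E → F} (hbot : ∀ y, ϑ y ≠ ⊥)
    {x v w : E} (hx : f x ∈ dom ϑ) (hw : w ∈ criticalCone (fun x => ϑ (f x)) x v) {ε : ℝ}
    (hε : 0 < ε) :
    ∃ᶠ p in 𝓝[>] (0 : ℝ) ×ˢ 𝓝 w, f (x + p.1 • p.2) ∈ dom ϑ ∧
      (ϑ (f (x + p.1 • p.2))).toReal ≤ (ϑ (f x)).toReal + p.1 * (⟪v, w⟫ + ε) := by
  have hpos : ∀ᶠ p in 𝓝[>] (0 : ℝ) ×ˢ 𝓝 w, 0 < p.1 :=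
    tendsto_fst.eventually self_mem_nhdsWithin
  have hw : subderiv (fun x => ϑ (f x)) x w = ((⟪v, w⟫ : ℝ) : EReal) := hw
  have hlt : subderiv (fun x => ϑ (f x)) x w < ((⟪v, w⟫ + ε : ℝ) : EReal) := by
    rw [hw, EReal.coe_lt_coe_iff]; linarith
  rw [subderiv, ← coe_toReal_of_mem_dom hbot hx] at hlt
  refine ((frequently_lt_of_liminf_lt (by isBoundedDefault) hlt).and_eventually hpos).mono ?_
  rintro p ⟨h1, h0⟩
  have h2 := (ereal_quotient_lt_iff' (hbot _) _ _ h0).1 h1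
  exact ⟨h2.1, h2.2.le⟩

/-- Off the domain the right-hand side is `⊤`, so growth only has to be checked at feasible points,
in real arithmetic. -/
theorem sum_ereal_le_iff {E F : Type*} {ϑ : F → EReal} {f : E → F} (hbot : ∀ y, ϑ y ≠ ⊥)
    {φ₀ : E → ℝ} {x : E} (hx : f x ∈ dom ϑ) (y : E) (a : ℝ) :
    (φ₀ x : EReal) + ϑ (f x) + (a : EReal) ≤ (φ₀ y : EReal) + ϑ (f y) ↔
      (f y ∈ dom ϑ → φ₀ x + (ϑ (f x)).toReal + a ≤ φ₀ y + (ϑ (f y)).toReal) := by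
  rw [← coe_toReal_of_mem_dom hbot hx]
  by_cases hy : f y ∈ dom ϑ
  · rw [← coe_toReal_of_mem_dom hbot hy]
    simp only [hy, forall_const, EReal.toReal_coe]
    exact_mod_cast Iff.rfl
  · have : ϑ (f y) = ⊤ := not_lt_top_iff.1 hy
    simp [hy, this]

/-! ### Critical cone, multipliers and the Lagrangian -/

section Composite

variable {E F : Type*} [NormedAddCommGroup E] [InnerProductSpace ℝ E]
  [NormedAddCommGroup F] [InnerProductSpace ℝ F] {ϑ : F → EReal} {f : E → F}

/-- Outside the critical cone, the second-order growth is arbitrarily fast. -/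
theorem secondOrderBound_of_notMem_criticalCone (hbot : ∀ y, ϑ y ≠ ⊥) {x v w : E} {lam : F}
    (hx : f x ∈ dom ϑ) (hd : DifferentiableAt ℝ f x)
    (hadj : ∀ h, ⟪lam, fderiv ℝ f x h⟫ = ⟪v, h⟫)
    (hlam : lam ∈ ConvexSubgrad (dom ϑ) (fun y => (ϑ y).toReal) (f x))
    (hw : w ∉ criticalCone (fun x => ϑ (f x)) x v) (μ : ℝ) :
    SecondOrderBound (dom ϑ) (fun y => (ϑ y).toReal) f x v w μ := by
  have hpos : ∀ᶠ p in 𝓝[>] (0 : ℝ) ×ˢ 𝓝 w, 0 < p.1 :=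
    tendsto_fst.eventually self_mem_nhdsWithin
  have hlow : ((⟪v, w⟫ : ℝ) : EReal) ≤ subderiv (fun x => ϑ (f x)) x w := by
    rw [subderiv, ← coe_toReal_of_mem_dom hbot hx]
    refine EReal.ge_of_forall_gt_iff_ge.1 fun b hb => ?_
    have hb : b < ⟪v, w⟫ := by exact_mod_cast hb
    refine le_liminf_of_le (by isBoundedDefault) ?_
    have hten : Tendsto (fun p : ℝ × E => ⟪lam, p.1⁻¹ • (f (x + p.1 • p.2) - f x)⟫)
        (𝓝[>] (0 : ℝ) ×ˢ 𝓝 w) (𝓝 ⟪v, w⟫) := by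
      rw [← hadj w]
      exact tendsto_const_nhds.inner (tendsto_difference_quotient hd w)
    filter_upwards [hpos, hten.eventually (lt_mem_nhds hb)] with p h0 h1
    rw [← not_lt, ereal_quotient_lt_iff' (hbot _) _ _ h0]
    rintro ⟨h2, h3⟩
    have h4 := hlam _ h2
    rw [inner_smul_right, inv_mul_eq_div, lt_div_iff₀ h0] at h1
    simp only at h4
    linarith
  -- A multiplier forces the subderivative to be at least `⟪v, w⟫`, so failure of criticality is a
  -- strict gap. After multiplication by `t` this gap absorbs `t² μ / 2`.
  have hlt : ((⟪v, w⟫ : ℝ) : EReal) < subderiv (fun x => ϑ (f x)) x w :=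
    lt_of_le_of_ne hlow fun h => hw h.symm
  obtain ⟨b, hb1, hb2⟩ := EReal.lt_iff_exists_real_btwn.1 hlt
  have hb1 : ⟪v, w⟫ < b := by exact_mod_cast hb1
  rw [subderiv, ← coe_toReal_of_mem_dom hbot hx] at hb2
  have hten : Tendsto (fun p : ℝ × E => ⟪v, p.2⟫ + p.1 / 2 * μ) (𝓝[>] (0 : ℝ) ×ˢ 𝓝 w)
      (𝓝 (⟪v, w⟫ + 0 / 2 * μ)) := by
    have h := Continuous.tendsto (f := fun p : ℝ × E => ⟪v, p.2⟫ + p.1 / 2 * μ) (by fun_prop)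
      ((0 : ℝ), w)
    rw [nhds_prod_eq] at h
    exact h.mono_left (prod_mono nhdsWithin_le_nhds le_rfl)
  rw [zero_div, zero_mul, add_zero] at hten
  filter_upwards [eventually_lt_of_lt_liminf hb2, hpos, hten.eventually (gt_mem_nhds hb1)] with
    p h1 h0 h2 h3
  have h4 := h1.not_gt
  rw [ereal_quotient_lt_iff' (hbot _) _ _ h0] at h4
  have h5 : ¬ (ϑ (f (x + p.1 • p.2))).toReal < (ϑ (f x)).toReal + p.1 * b := fun h => h4 ⟨h3, h⟩
  have h6 := mul_lt_mul_of_pos_left h2 h0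
  linarith

theorem mem_multipliers_iff [CompleteSpace E] [CompleteSpace F] (h : IsConvexFun ϑ)
    (hbot : ∀ y, ϑ y ≠ ⊥) {x v : E} (hx : f x ∈ dom ϑ) {lam : F} :
    lam ∈ multipliers ϑ f x v ↔ (∀ h, ⟪lam, fderiv ℝ f x h⟫ = ⟪v, h⟫) ∧
      lam ∈ ConvexSubgrad (dom ϑ) (fun y => (ϑ y).toReal) (f x) := by
  rw [← mem_limitingSubdiff_iff h hbot hx]
  refine and_congr_left fun _ => ⟨fun h1 k => ?_, fun h1 => ext_inner_right ℝ fun k => ?_⟩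
  · rw [← ContinuousLinearMap.adjoint_inner_left, h1]
  · rw [ContinuousLinearMap.adjoint_inner_left, h1]

/-- Limiting subgradients of the composition come from multipliers. -/
theorem multipliers_nonempty [FiniteDimensional ℝ E] [FiniteDimensional ℝ F] [CompleteSpace E]
    [CompleteSpace F] (hconv : IsConvexFun ϑ) (hpw : IsPWLQ ϑ) {x₀ v₀ : E} (hx₀ : f x₀ ∈ dom ϑ)
    (hd : ∀ᶠ x in 𝓝 x₀, DifferentiableAt ℝ f x) (hfd : ContinuousAt (fderiv ℝ f) x₀)
    (hf : ∃ (K : NNReal), ∃ s ∈ 𝓝 x₀, LipschitzOnWith K f s) {κ C : ℝ} (hκ : 0 ≤ κ) (hC : 0 ≤ C)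
    (hpen : ∀ᶠ x in 𝓝 x₀, f x ∈ dom ϑ →
      PenaltyAt (dom ϑ) (fun y => (ϑ y).toReal) f κ C x)
    (hv : v₀ ∈ limitingSubdiff (fun x => ϑ (f x)) x₀) :
    (multipliers ϑ f x₀ v₀).Nonempty := by
  obtain ⟨-, X, u, hX, hXlim, hulim, hreg⟩ := hv
  have hfst : Continuous (fun z : WithLp 2 (E × ℝ) => z.fst) :=
    continuous_fst.comp (WithLp.prod_continuous_ofLp 2 E ℝ)
  have hsnd : Continuous (fun z : WithLp 2 (E × ℝ) => z.snd) :=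
    continuous_snd.comp (WithLp.prod_continuous_ofLp 2 E ℝ)
  have hx : Tendsto (fun k => (X k).fst) atTop (𝓝 x₀) := (hfst.tendsto _).comp hXlim
  have hu1 : Tendsto (fun k => (u k).fst) atTop (𝓝 v₀) := (hfst.tendsto _).comp hulim
  have hu2 : Tendsto (fun k => (u k).snd) atTop (𝓝 (-1)) := (hsnd.tendsto _).comp hulim
  -- Nearby normals need not have last component `-1`, but theirs tends to `-1`; rescaling
  -- normalizes it without changing the limit.
  have hvk : Tendsto (fun k => (-(u k).snd)⁻¹ • (u k).fst) atTop (𝓝 v₀) := by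
    have := (hu2.neg.inv₀ (by norm_num)).smul hu1
    simpa using this
  obtain ⟨M, hM, hlip⟩ := exists_lipschitz_comp hpw.isPWLQOn (hconv.convexOn hpw.1) hf
  obtain ⟨lam, h1, h2⟩ := exists_multiplier_of_limiting hpw.isPWLQOn (hconv.convexOn hpw.1) hx₀ hd
    hfd hκ hC hpen hx hvk (by
      filter_upwards [hx.eventually hlip, hu2.eventually (gt_mem_nhds (by norm_num : (-1 : ℝ) < 0))]
        with k h1 h2
      have hmem : f (X k).fst ∈ dom ϑ := lt_of_le_of_lt (hX k) (EReal.coe_lt_top _)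
      exact ⟨hmem, fun ε hε => regular_subgradient_of_normal (φ := fun x => ϑ (f x))
        (fun x => hpw.1 _) (hX k) (hreg k) h2 hM (h1 hmem) hε⟩)
  refine ⟨lam, (mem_multipliers_iff hconv hpw.1 hx₀).2 ⟨fun h => ?_, h2⟩⟩
  rw [← ContinuousLinearMap.adjoint_inner_left, h1]

/-- The conjugate term is constant in `x`, so it disappears on differentiation. -/
theorem lagrangianHessian_eq {φ₀ : E → ℝ} {x : E} (hφ₀ : TwiceDifferentiableAt φ₀ x)
    (hf : TwiceDifferentiableAt f x) (lam : F) (w : E) :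
    lagrangianHessian φ₀ ϑ f x lam w =
      fderiv ℝ (fderiv ℝ φ₀) x w w + ⟪lam, fderiv ℝ (fderiv ℝ f) x w w⟫ := by
  have h1 : fderiv ℝ (fun x => lagrangian φ₀ ϑ f x lam) =ᶠ[𝓝 x]
      fun y => fderiv ℝ φ₀ y + (innerSL ℝ lam).comp (fderiv ℝ f y) := by
    filter_upwards [hφ₀.1, hf.1] with y hy1 hy2
    exact ((hy1.hasFDerivAt.add ((innerSL ℝ lam).hasFDerivAt.comp y hy2.hasFDerivAt)).sub_const
      _).fderiv
  have h2 : HasFDerivAt (fun y => fderiv ℝ φ₀ y + (innerSL ℝ lam).comp (fderiv ℝ f y))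
      (fderiv ℝ (fderiv ℝ φ₀) x + (ContinuousLinearMap.compL ℝ E F ℝ (innerSL ℝ lam)).comp
        (fderiv ℝ (fderiv ℝ f) x)) x :=
    hφ₀.2.hasFDerivAt.add
      ((ContinuousLinearMap.compL ℝ E F ℝ (innerSL ℝ lam)).hasFDerivAt.comp x hf.2.hasFDerivAt)
  rw [lagrangianHessian, h1.fderiv_eq, h2.fderiv]
  simp

theorem TwiceDifferentiableAt.exists_lipschitzOnWith {x₀ : E} (hf : TwiceDifferentiableAt f x₀) :
    ∃ (K : NNReal), ∃ s ∈ 𝓝 x₀, LipschitzOnWith K f s :=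
  (hasStrictFDerivAt_of_hasFDerivAt_of_continuousAt
    (hf.1.mono fun _ h => h.hasFDerivAt) hf.2.continuousAt).exists_lipschitzOnWith

end Composite

end CompositeOpt

/-! ### The second-order optimality conditions -/

open CompositeOpt in
theorem theorem6p1 (n m : ℕ)
    (φ₀ : EuclideanSpace ℝ (Fin n) → ℝ)
    (f : EuclideanSpace ℝ (Fin n) → EuclideanSpace ℝ (Fin m))
    (ϑ : EuclideanSpace ℝ (Fin m) → EReal)
    (xbar : EuclideanSpace ℝ (Fin n))
    (hφ₀ : CompositeOpt.TwiceDifferentiableAt φ₀ xbar)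
    (hf : CompositeOpt.TwiceDifferentiableAt f xbar)
    (hconv : CompositeOpt.IsConvexFun ϑ)
    (hpwlq : CompositeOpt.IsPWLQ ϑ)
    (hdom : f xbar ∈ CompositeOpt.dom ϑ)
    (hmsqc : CompositeOpt.MSQC ϑ f xbar)
    (φ ψ : EuclideanSpace ℝ (Fin n) → EReal)
    (hφ : φ = fun x => ϑ (f x))
    (hψ : ψ = fun x => (φ₀ x : EReal) + ϑ (f x))
    (vbar : EuclideanSpace ℝ (Fin n))
    (hvbar : vbar = -gradient φ₀ xbar)
    (hstat : ∃ v ∈ CompositeOpt.limitingSubdiff φ xbar, 0 = gradient φ₀ xbar + v)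
    (K : Set (EuclideanSpace ℝ (Fin n)))
    (hK : K = CompositeOpt.criticalCone φ xbar vbar)
    (Λ : Set (EuclideanSpace ℝ (Fin m)))
    (hΛ : Λ = CompositeOpt.multipliers ϑ f xbar vbar) :
    -- there are multipliers, and the maximum over them is attained in critical directions
    Λ.Nonempty ∧
    (∀ w ∈ K, ∃ lam₁ ∈ Λ, ∀ lam ∈ Λ,
      CompositeOpt.lagrangianHessian φ₀ ϑ f xbar lam w ≤
        CompositeOpt.lagrangianHessian φ₀ ϑ f xbar lam₁ w) ∧
    -- the second-order necessary condition
    (IsLocalMin ψ xbar → ∀ lambar ∈ Λ, ∀ w ∈ K,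
      0 ≤ CompositeOpt.secondOrderExpr φ₀ ϑ f xbar Λ lambar w) ∧
    -- the strict condition amounts to quadratic growth, and so implies local optimality
    (∀ lambar ∈ Λ,
      ((∀ w ∈ K \ {0}, 0 < CompositeOpt.secondOrderExpr φ₀ ϑ f xbar Λ lambar w) ↔
        CompositeOpt.QuadraticGrowth ψ xbar)) ∧
    (∀ lambar ∈ Λ,
      (∀ w ∈ K \ {0}, 0 < CompositeOpt.secondOrderExpr φ₀ ϑ f xbar Λ lambar w) →
        IsLocalMin ψ xbar) := by
  subst hφ hψ hK hΛ
  have hbot := hpwlq.1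
  have hD := hpwlq.isPWLQOn
  have hc := hconv.convexOn hbot
  set D := dom ϑ with hDdef
  set θ : EuclideanSpace ℝ (Fin m) → ℝ := fun y => (ϑ y).toReal with hθdef
  have hlip := hf.exists_lipschitzOnWith
  have hm : ∃ κ : ℝ, 0 ≤ κ ∧ ∀ᶠ x in 𝓝 xbar,
      Metric.infDist x {z | f z ∈ D} ≤ κ * Metric.infDist (f x) D := hmsqc
  obtain ⟨κ, C, hκ, hC, hpen⟩ := exists_penalty hD hc hlip hdom hm
  have hpen₀ := hpen.self_of_nhds hdom
  have hgrad : ∀ h, fderiv ℝ φ₀ xbar h = -⟪vbar, h⟫ := fun h => by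
    rw [hvbar, inner_neg_left, neg_neg, gradient, InnerProductSpace.toDual_symm_apply]
  have hvsub : vbar ∈ limitingSubdiff (fun x => ϑ (f x)) xbar := by
    obtain ⟨v, hv, h0⟩ := hstat
    rw [hvbar, neg_eq_of_add_eq_zero_right h0.symm]
    exact hv
  have hne := multipliers_nonempty hconv hpwlq hdom hf.1 hf.2.continuousAt hlip hκ hC hpen hvsub
  have hmem : ∀ {lam}, lam ∈ multipliers ϑ f xbar vbar ↔ _ := fun {lam} =>
    mem_multipliers_iff hconv hbot hdom
  obtain ⟨lam₀, hlam₀⟩ := id hne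
  have hlam₀' := hmem.1 hlam₀
  set K := criticalCone (fun x => ϑ (f x)) xbar vbar with hK
  -- in critical directions, both terms of the second-order expression are attained real numbers
  have hcrit : ∀ w ∈ K, ∃ c : ℝ, ∃ lam₁ ∈ multipliers ϑ f xbar vbar,
      (∀ lam ∈ multipliers ϑ f xbar vbar, lagrangianHessian φ₀ ϑ f xbar lam w ≤
        lagrangianHessian φ₀ ϑ f xbar lam₁ w) ∧
      (∀ lambar ∈ multipliers ϑ f xbar vbar,
        secondOrderExpr φ₀ ϑ f xbar (multipliers ϑ f xbar vbar) lambar w =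
          ((c + lagrangianHessian φ₀ ϑ f xbar lam₁ w : ℝ) : EReal)) ∧
      (∀ μ, SecondOrderBound D θ f xbar vbar w (μ - fderiv ℝ (fderiv ℝ φ₀) xbar w w) →
        μ ≤ c + lagrangianHessian φ₀ ϑ f xbar lam₁ w) ∧
      ∀ μ, μ < c + lagrangianHessian φ₀ ϑ f xbar lam₁ w →
        SecondOrderBound D θ f xbar vbar w (μ - fderiv ℝ (fderiv ℝ φ₀) xbar w w) := by
    intro w hw
    obtain ⟨c, hray⟩ := exists_ray_of_critical hD hf.1.self_of_nhds hlam₀'.1 hlam₀'.2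
      fun ε hε => frequently_of_mem_criticalCone hbot hdom hw hε
    obtain ⟨lam₁, h1, h2, h3, h4⟩ := exists_maximal_multiplier hD hc hκ hC hdom hpen₀ hf.1 hf.2 hray
      hlam₀'.1 hlam₀'.2
    have hlam₁ : lam₁ ∈ multipliers ϑ f xbar vbar := hmem.2 ⟨h1, h2⟩
    have hmax : ∀ lam ∈ multipliers ϑ f xbar vbar, lagrangianHessian φ₀ ϑ f xbar lam w ≤
        lagrangianHessian φ₀ ϑ f xbar lam₁ w := fun lam hlam => by
      rw [lagrangianHessian_eq hφ₀ hf, lagrangianHessian_eq hφ₀ hf]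
      have := h3 lam (hmem.1 hlam).1 (hmem.1 hlam).2
      linarith
    refine ⟨c, lam₁, hlam₁, hmax, fun lambar hlambar => ?_, fun μ hμ => ?_, fun μ hμ => ?_⟩
    · have hb := hmem.1 hlambar
      have hsup : (⨆ lam ∈ multipliers ϑ f xbar vbar,
          (lagrangianHessian φ₀ ϑ f xbar lam w : EReal)) =
          (lagrangianHessian φ₀ ϑ f xbar lam₁ w : EReal) :=
        le_antisymm (iSup₂_le fun lam hlam => EReal.coe_le_coe_iff.2 (hmax lam hlam))
          (le_iSup₂ (f := fun lam (_ : lam ∈ multipliers ϑ f xbar vbar) =>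
            (lagrangianHessian φ₀ ϑ f xbar lam w : EReal)) lam₁ hlam₁)
      -- The ray expansion involves a multiplier only through `⟪lambar, ∇f w⟫ = ⟪vbar, w⟫`, so the
      -- curvature `c` is the same for every `lambar`.
      rw [secondOrderExpr, hsup, secondSubderiv_eq_of_ray hpwlq hdom hb.2 (c := c)
        (by rw [hb.1 w]; exact hray), EReal.coe_add]
    · have := h4 _ hμ
      rw [lagrangianHessian_eq hφ₀ hf]
      linarith
    · rw [lagrangianHessian_eq hφ₀ hf] at hμ
      exact secondOrderBound_of_multiplier hD hf.1 hf.2 h1 h2 hray (by linarith)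
  have hsmall : ∀ w, Tendsto (fun p : ℝ × EuclideanSpace ℝ (Fin n) => xbar + p.1 • p.2)
      (𝓝[>] (0 : ℝ) ×ˢ 𝓝 w) (𝓝 xbar) := fun w => tendsto_add_smul_nhds xbar w
  have hgrowth : ∀ lambar ∈ multipliers ϑ f xbar vbar,
      ((∀ w ∈ K \ {0},
        0 < secondOrderExpr φ₀ ϑ f xbar (multipliers ϑ f xbar vbar) lambar w) ↔
        QuadraticGrowth (fun x => (φ₀ x : EReal) + ϑ (f x)) xbar) := by
    intro lambar hlambar
    constructor
    · intro hpos
      obtain ⟨ℓ, hℓ, ε, hε, H⟩ := quadratic_growth_of_directional (S := {x | f x ∈ D})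
        (g := fun x => φ₀ x + θ (f x)) (x := xbar) (fun w hw0 => by
          by_cases hw : w ∈ K
          · obtain ⟨c, lam₁, -, -, h1, -, h2⟩ := hcrit w hw
            have h3 := hpos w ⟨hw, hw0⟩
            rw [h1 lambar hlambar] at h3
            have h3 : 0 < c + lagrangianHessian φ₀ ϑ f xbar lam₁ w := by exact_mod_cast h3
            obtain ⟨μ, h4, h5⟩ := exists_between h3
            exact ⟨μ / 2, half_pos h4,
              growth_of_secondOrderBound hφ₀ hgrad (half_lt_self h4) (h2 μ h5)⟩
          · exact ⟨1, one_pos, growth_of_secondOrderBound hφ₀ hgrad one_lt_two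
              (secondOrderBound_of_notMem_criticalCone hbot hdom hf.1.self_of_nhds hlam₀'.1
                hlam₀'.2 hw _)⟩)
      exact ⟨ℓ, hℓ, ε, hε, fun y hy => (sum_ereal_le_iff hbot hdom y _).2 (H y hy)⟩
    · rintro ⟨ℓ, hℓ, ε, hε, H⟩ w ⟨hw, hw0⟩
      obtain ⟨c, lam₁, -, -, h1, h2, -⟩ := hcrit w hw
      have hw0 : 0 < ‖w‖ := norm_pos_iff.2 hw0
      have hn : ∀ᶠ p in 𝓝[>] (0 : ℝ) ×ˢ 𝓝 w, ‖w‖ / 2 < ‖p.2‖ :=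
        (tendsto_snd.norm).eventually (lt_mem_nhds (half_lt_self hw0))
      -- Since `‖p.2‖ > ‖w‖ / 2`, the growth is at least `t² / 2` times `ℓ ‖w‖² / 2`; half of this
      -- modulus is given up to the Taylor remainder of `φ₀`.
      have hg : SecondOrderBound D θ f xbar vbar w
          (ℓ * ‖w‖ ^ 2 / 4 - fderiv ℝ (fderiv ℝ φ₀) xbar w w) := by
        refine secondOrderBound_of_growth hφ₀ hgrad (μ := ℓ * ‖w‖ ^ 2 / 2)
          (by have : 0 < ℓ * ‖w‖ ^ 2 := by positivity
              linarith) ?_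
        filter_upwards [(hsmall w).eventually (Metric.closedBall_mem_nhds xbar hε), hn] with
          p hp hpn hpD
        have h3 := (sum_ereal_le_iff hbot hdom _ _).1 (H _ hp) hpD
        rw [add_sub_cancel_left, norm_smul, mul_pow, Real.norm_eq_abs, sq_abs] at h3
        have h4 : ℓ * (p.1 ^ 2 * (‖w‖ / 2) ^ 2) ≤ ℓ * (p.1 ^ 2 * ‖p.2‖ ^ 2) := by gcongr
        linarith
      rw [h1 lambar hlambar]
      have h5 := h2 _ hg
      have h6 : 0 < ℓ * ‖w‖ ^ 2 / 4 := by positivity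
      exact_mod_cast h6.trans_le h5
  refine ⟨hne, fun w hw => ?_, fun hmin lambar hlambar w hw => ?_, hgrowth,
    fun lambar hlambar hpos => ?_⟩
  · obtain ⟨-, lam₁, h1, h2, -⟩ := hcrit w hw
    exact ⟨lam₁, h1, h2⟩
  · obtain ⟨c, lam₁, -, -, h1, h2, -⟩ := hcrit w hw
    rw [h1 lambar hlambar]
    have h3 : 0 ≤ c + lagrangianHessian φ₀ ϑ f xbar lam₁ w := by
      -- Local minimality is growth with modulus `0`, so every negative modulus is admissible after
      -- the Taylor remainder of `φ₀` is absorbed.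
      refine le_of_forall_lt fun μ hμ => ?_
      obtain ⟨μ', h4, h5⟩ := exists_between hμ
      refine h4.trans_le (h2 μ' (secondOrderBound_of_growth hφ₀ hgrad h5 ?_))
      filter_upwards [(hsmall w).eventually hmin] with p hp hpD
      have h6 := (sum_ereal_le_iff hbot hdom (xbar + p.1 • p.2) 0).1 (by simpa using hp) hpD
      simpa using h6
    exact_mod_cast h3
  · obtain ⟨ℓ, hℓ, ε, hε, H⟩ := (hgrowth lambar hlambar).1 hpos
    filter_upwards [Metric.closedBall_mem_nhds xbar hε] with y hy
    refine le_trans ?_ (H y hy)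
    have h1 : (0 : EReal) ≤ ((ℓ * ‖y - xbar‖ ^ 2 : ℝ) : EReal) := by
      have : 0 ≤ ℓ * ‖y - xbar‖ ^ 2 := by positivity
      exact_mod_cast this
    simpa using add_le_add_right h1 ((φ₀ xbar : EReal) + ϑ (f xbar))
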